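/- Let $G$ be a group with neutral element $\varepsilon$ and let $R=\bigoplus_{g\in G}R_g$ be a $G$-graded (associative, unital) ring which is graded Artinian, i.e. satisfies the descending chain condition on graded left ideals and on graded right ideals. For a graded left module $M$ and $\sigma\in G$ let $M(\sigma)$ be the same module with the grading $M(\sigma)_g=M_{g\sigma}$; for a graded right module $M$ let $(\sigma)M$ be the same module with the grading $((\sigma)M)_g=M_{\sigma g}$. Isomorphisms of graded modules preserve degrees, and two graded left modules $M,N$ have the same isoshift type if $M\simeq N(\sigma)$ for some $\sigma\in G$. The graded socle $\mathrm{soc}^{\mathrm{gr}}(M)$ is the sum of all graded simple submodules of $M$, and $J=J^{\mathrm{gr}}(R)$ is the graded Jacobson radical, the intersection of all maximal graded left ideals. The principal graded indecomposable left modules are the terms of the decompositions of $R$ into a finite direct sum of graded indecomposable left ideals. Let $e_1,\dots,e_t\in R_\varepsilon$ be idempotents such that $Re_1,\dots,Re_t$ is a system of representatives for the isoshift types of principal graded indecomposable left $R$-modules, and let $S_i=Re_i/Je_i$ and $S'_i=e_iR/e_iJ$ for $1\le i\le t$. Then the following are equivalent. (1) $R$ is graded quasi-Frobenius, i.e. $R$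 is graded Artinian, every graded right ideal $A$ satisfies $\mathrm{ann}_r(\mathrm{ann}_\ell A)=A$, and every graded left ideal $U$ satisfies $\mathrm{ann}_\ell(\mathrm{ann}_r U)=U$. (2) There exist a permutation $\pi$ of $\{1,\dots,t\}$ and elements $\sigma_1,\dots,\sigma_t\in G$ such that, for every $1\le i\le t$, $\mathrm{soc}^{\mathrm{gr}}(Re_i)\simeq S_{\pi(i)}(\sigma_i)$ as graded left $R$-modules and $\mathrm{soc}^{\mathrm{gr}}(e_{\pi(i)}R)\simeq(\sigma_i)S'_i$ as graded right $R$-modules. -/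

import Mathlib

namespace GradedQF

/-!
The grading group is written additively but is not assumed commutative. A right `R`-module is a
module over `Rᵐᵒᵖ`, so right ideals of `R` are terms of `Submodule Rᵐᵒᵖ R`. The scalar ring `S`
below is instantiated to `R` (left modules) and to `Rᵐᵒᵖ` (right modules).
-/

section Modules

variable {G S M N : Type*} [Ring S] [AddCommGroup M] [Module S M] [AddCommGroup N] [Module S N]

/-- The grading `p_g = p ∩ M_g` of a submodule `p` of a module `M` with homogeneous
components `ℳ`. -/
def subGrading (ℳ : G → AddSubgroup M) (p : Submodule S M) (g : G) : AddSubgroup p :=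
  (ℳ g).comap p.subtype.toAddMonoidHom

/-- The grading of a quotient module: `(M / p)_g` is the image of `M_g`. -/
def quotGrading (ℳ : G → AddSubgroup M) (p : Submodule S M) (g : G) : AddSubgroup (M ⧸ p) :=
  (ℳ g).map p.mkQ.toAddMonoidHom

/-- The shift `M(σ)` of a graded left module: `M(σ)_g = M_{g + σ}`. -/
def leftShift [Add G] (ℳ : G → AddSubgroup M) (σ : G) (g : G) : AddSubgroup M := ℳ (g + σ)

/-- The shift `(σ)M` of a graded right module: `((σ)M)_g = M_{σ + g}`. -/
def rightShift [Add G] (σ : G) (ℳ : G → AddSubgroup M) (g : G) : AddSubgroup M := ℳ (σ + g)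

variable (S) in
/-- Two graded modules are isomorphic as graded modules, by an isomorphism of modules that
matches the homogeneous components of the same degree. -/
def GradedIso (ℳ : G → AddSubgroup M) (𝒩 : G → AddSubgroup N) : Prop :=
  ∃ f : M ≃ₗ[S] N, ∀ g x, x ∈ ℳ g ↔ f x ∈ 𝒩 g

variable (S) in
/-- Two graded left modules have the same isoshift type: `M ≅ N(σ)` for some `σ`. -/
def SameIsoshiftType [Add G] (ℳ : G → AddSubgroup M) (𝒩 : G → AddSubgroup N) : Prop :=
  ∃ σ : G, GradedIso S ℳ (leftShift 𝒩 σ)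

variable [DecidableEq G] (ℳ : G → AddSubgroup M) [DirectSum.Decomposition ℳ]

variable (S) in
/-- The descending chain condition on graded submodules. -/
def IsGradedArtinian : Prop :=
  WellFoundedLT {p : Submodule S M // p.IsHomogeneous ℳ}

/-- The graded submodule `p` of `M` is graded simple: it is nonzero and has no graded submodules
other than `0` and itself. -/
structure IsGradedSimple (p : Submodule S M) : Prop where
  homogeneous : p.IsHomogeneous ℳ
  ne_bot : p ≠ ⊥
  eq_bot_or_eq : ∀ q : Submodule S M, q.IsHomogeneous ℳ → q ≤ p → q = ⊥ ∨ q = p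

/-- The graded submodule `p` of `M` is graded indecomposable: it is nonzero and is not the direct
sum of two nonzero graded submodules. -/
structure IsGradedIndecomposable (p : Submodule S M) : Prop where
  homogeneous : p.IsHomogeneous ℳ
  ne_bot : p ≠ ⊥
  eq_bot_or_eq_bot : ∀ a b : Submodule S M, a.IsHomogeneous ℳ → b.IsHomogeneous ℳ →
    a ⊓ b = ⊥ → a ⊔ b = p → a = ⊥ ∨ b = ⊥

/-- The graded socle of the graded submodule `p` of `M`: the sum of all graded simple submodules
of `p`. -/
def gradedSocle (p : Submodule S M) : Submodule S M :=
  sSup {q | q ≤ p ∧ IsGradedSimple ℳ q}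

/-- A maximal graded submodule: maximal among the proper graded submodules. -/
structure IsGradedMaximal (p : Submodule S M) : Prop where
  homogeneous : p.IsHomogeneous ℳ
  ne_top : p ≠ ⊤
  eq_top : ∀ q : Submodule S M, q.IsHomogeneous ℳ → p < q → q = ⊤

end Modules

section Rings

variable {G R : Type*} [Ring R]

/-- The left annihilator of a subset of `R`, a left ideal. -/
def leftAnn (s : Set R) : Submodule R R where
  carrier := {x | ∀ a ∈ s, x * a = 0}
  add_mem' hx hy a ha := by rw [add_mul, hx a ha, hy a ha, add_zero]
  zero_mem' a _ := zero_mul a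
  smul_mem' r x hx a ha := by rw [smul_eq_mul, mul_assoc, hx a ha, mul_zero]

/-- The right annihilator of a subset of `R`, a right ideal. -/
def rightAnn (s : Set R) : Submodule Rᵐᵒᵖ R where
  carrier := {x | ∀ a ∈ s, a * x = 0}
  add_mem' hx hy a ha := by rw [mul_add, hx a ha, hy a ha, add_zero]
  zero_mem' a _ := mul_zero a
  smul_mem' r x hx a ha := by
    rw [← MulOpposite.op_unop r, op_smul_eq_mul, ← mul_assoc, hx a ha, zero_mul]

/-- The left ideal `Re`. -/
def leftIdeal (e : R) : Submodule R R := Submodule.span R {e}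

/-- The right ideal `eR`. -/
def rightIdeal (e : R) : Submodule Rᵐᵒᵖ R := Submodule.span Rᵐᵒᵖ {e}

variable [AddGroup G] [DecidableEq G] (𝒜 : G → AddSubgroup R) [GradedRing 𝒜]

/-- A graded ring is graded Artinian if it is graded left Artinian and graded right Artinian. -/
def IsGradedArtinianRing : Prop :=
  IsGradedArtinian R 𝒜 ∧ IsGradedArtinian Rᵐᵒᵖ 𝒜

/-- Graded quasi-Frobenius rings: graded Artinian rings with the double annihilator conditions
for graded right ideals and for graded left ideals. -/
structure IsGradedQuasiFrobenius : Prop where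
  artinian : IsGradedArtinianRing 𝒜
  right_double_ann : ∀ A : Submodule Rᵐᵒᵖ R, A.IsHomogeneous 𝒜 →
    rightAnn (leftAnn (A : Set R) : Set R) = A
  left_double_ann : ∀ U : Submodule R R, U.IsHomogeneous 𝒜 →
    leftAnn (rightAnn (U : Set R) : Set R) = U

/-- The graded Jacobson radical `J`: the intersection of all maximal graded left ideals. -/
def gradedJacobson : Submodule R R :=
  sInf {I | IsGradedMaximal 𝒜 I}

/-- `Je = {xe : x ∈ J}`, for the graded Jacobson radical `J`. -/
def jacobsonMul (e : R) : Submodule R R :=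
  Submodule.span R ((fun x => x * e) '' (gradedJacobson 𝒜 : Set R))

/-- `eJ = {ex : x ∈ J}`, for the graded Jacobson radical `J` (which is a two-sided ideal). -/
def mulJacobson (e : R) : Submodule Rᵐᵒᵖ R :=
  Submodule.span Rᵐᵒᵖ ((fun x => e * x) '' (gradedJacobson 𝒜 : Set R))

/-- The module underlying `Re / Je`. -/
abbrev LeftTop (e : R) : Type _ :=
  leftIdeal e ⧸ (jacobsonMul 𝒜 e).submoduleOf (leftIdeal e)

/-- The module underlying `eR / eJ`. -/
abbrev RightTop (e : R) : Type _ :=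
  rightIdeal e ⧸ (mulJacobson 𝒜 e).submoduleOf (rightIdeal e)

/-- The grading of the left module `Re / Je`. -/
def leftTopGrading (e : R) : G → AddSubgroup (LeftTop 𝒜 e) :=
  quotGrading (subGrading 𝒜 (leftIdeal e)) ((jacobsonMul 𝒜 e).submoduleOf (leftIdeal e))

/-- The grading of the right module `eR / eJ`. -/
def rightTopGrading (e : R) : G → AddSubgroup (RightTop 𝒜 e) :=
  quotGrading (subGrading 𝒜 (rightIdeal e)) ((mulJacobson 𝒜 e).submoduleOf (rightIdeal e))

/-- `P` is a principal graded indecomposable left module: a term of a decomposition of `R` into a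
finite direct sum of graded indecomposable left ideals. -/
def IsPrincipalGradedIndecomposable (P : Submodule R R) : Prop :=
  ∃ (n : ℕ) (Q : Fin n → Submodule R R), DirectSum.IsInternal Q ∧
    (∀ k, IsGradedIndecomposable 𝒜 (Q k)) ∧ ∃ k, Q k = P

/-- `e₁, …, e_t` are idempotents of degree zero such that `Re₁, …, Re_t` is a system of
representatives for the isoshift types of principal graded indecomposable left modules. -/
structure IsRepresentativeSystem {t : ℕ} (e : Fin t → R) : Prop where
  mem_zero : ∀ i, e i ∈ 𝒜 0
  idempotent : ∀ i, IsIdempotentElem (e i)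
  principal : ∀ i, IsPrincipalGradedIndecomposable 𝒜 (leftIdeal (e i))
  distinct : ∀ i j, SameIsoshiftType R (subGrading 𝒜 (leftIdeal (e i)))
    (subGrading 𝒜 (leftIdeal (e j))) → i = j
  exhaustive : ∀ P : Submodule R R, IsPrincipalGradedIndecomposable 𝒜 P →
    ∃ i, SameIsoshiftType R (subGrading 𝒜 P) (subGrading 𝒜 (leftIdeal (e i)))

end Rings

end GradedQF

/-! Write L and T for the elements killed by J from the left and from the right; they cut out the
socles of left and right graded ideals (`gradedSocle_eq`, `gradedSocle_eq_right`). Two facts carry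
every argument: for a primitive idempotent e of degree zero, a homogeneous element of Re or eR
outside J can be multiplied back to e (`exists_left_inv`, `exists_right_inv`), and the e_i generate
R as a two-sided ideal (`one_mem_closure`).

(2) ⇒ (1). The isomorphisms provide homogeneous generators: soc(Re_i) = Rx with e_{π(i)}x = x, and
soc(e_{π(i)}R) = yR with ye_i = y. Since Ry is nonzero inside Re_i, it contains the simple socle of
Re_i, so Le_i ⊆ Ry ⊆ T; symmetrically T ⊆ L. Now Le_i and e_iT are graded simple, so annihilators
send a cover to an equality or a cover (`rightAnn_between`, `leftAnn_between`), and the chain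
conditions propagate closedness from 0 to every graded ideal (`closed_of_covBy`).

(1) ⇒ (2). A nonzero homogeneous w = we_i in T generates the least nonzero graded left ideal inside
Re_i, by the double annihilator condition; hence T ⊆ L. Choose such an x_i with e_{k(i)}x_i = x_i.
It generates both soc(Re_i) and soc(e_{k(i)}R), and multiplication by x_i gives both isomorphisms
with the same shift. Generators of one right socle differ by a factor invertible between the e_i
(`sameIsoshiftType`), so k is injective, hence a permutation. -/

namespace GradedQF

open DirectSum

/-! ### Graded submodules and homogeneous elements. -/

section Homogeneous

variable {G S M : Type*} [Ring S] [AddCommGroup M] [Module S M] [DecidableEq G]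
  {ℳ : G → AddSubgroup M} [DirectSum.Decomposition ℳ]

theorem isHomogeneous_bot : (⊥ : Submodule S M).IsHomogeneous ℳ := by
  intro g x hx
  rw [Submodule.mem_bot] at hx ⊢
  simp [hx]

theorem isHomogeneous_inf {p q : Submodule S M} (hp : p.IsHomogeneous ℳ)
    (hq : q.IsHomogeneous ℳ) : (p ⊓ q).IsHomogeneous ℳ :=
  fun g _ hx => ⟨hp g hx.1, hq g hx.2⟩

theorem isHomogeneous_sInf {s : Set (Submodule S M)} (hs : ∀ p ∈ s, p.IsHomogeneous ℳ) :
    (sInf s).IsHomogeneous ℳ := by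
  intro g x hx
  rw [Submodule.mem_sInf] at hx ⊢
  exact fun p hp => hs p hp g (hx p hp)

theorem isHomogeneous_sup {p q : Submodule S M} (hp : p.IsHomogeneous ℳ)
    (hq : q.IsHomogeneous ℳ) : (p ⊔ q).IsHomogeneous ℳ := by
  intro g x hx
  rw [Submodule.mem_sup] at hx ⊢
  obtain ⟨y, hy, z, hz, rfl⟩ := hx
  exact ⟨_, hp g hy, _, hq g hz, by simp [decompose_add]⟩

/-- A property of elements that is closed under addition and holds for the homogeneous components
of `x` holds for `x`. -/
theorem mem_of_components_mem (H : AddSubgroup M) {x : M}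
    (h : ∀ g, (decompose ℳ x g : M) ∈ H) : x ∈ H := by
  classical
  rw [← sum_support_decompose ℳ x]
  exact sum_mem fun g _ => h g

theorem le_of_homogeneous_mem {p q : Submodule S M} (hp : p.IsHomogeneous ℳ)
    (h : ∀ g, ∀ x ∈ ℳ g, x ∈ p → x ∈ q) : p ≤ q := fun _ hx =>
  mem_of_components_mem (ℳ := ℳ) q.toAddSubgroup fun g => h g _ (SetLike.coe_mem _) (hp g hx)

theorem exists_homogeneous_mem_notMem {p q : Submodule S M} (hp : p.IsHomogeneous ℳ)
    (h : ¬ p ≤ q) : ∃ g, ∃ x ∈ ℳ g, x ∈ p ∧ x ∉ q := by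
  by_contra! hc
  exact h (le_of_homogeneous_mem hp hc)

theorem exists_homogeneous_ne_zero {p : Submodule S M} (hp : p.IsHomogeneous ℳ)
    (h : p ≠ ⊥) : ∃ g, ∃ x ∈ ℳ g, x ∈ p ∧ x ≠ 0 := by
  obtain ⟨g, x, hx, hxp, hx0⟩ := exists_homogeneous_mem_notMem hp (fun hc => h (le_bot_iff.1 hc))
  exact ⟨g, x, hx, hxp, fun h0 => hx0 (by simp [h0])⟩

end Homogeneous

/-! ### Principal one-sided ideals and the graded radical. -/

section Rings

variable {G R : Type*} [Ring R]

theorem mem_leftIdeal {e x : R} : x ∈ leftIdeal e ↔ ∃ a, a * e = x :=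
  Submodule.mem_span_singleton

theorem mem_rightIdeal {e x : R} : x ∈ rightIdeal e ↔ ∃ a, e * a = x := by
  refine Submodule.mem_span_singleton.trans ⟨?_, ?_⟩
  · rintro ⟨a, rfl⟩
    exact ⟨a.unop, rfl⟩
  · rintro ⟨a, rfl⟩
    exact ⟨MulOpposite.op a, rfl⟩

theorem mul_mem_leftIdeal (a e : R) : a * e ∈ leftIdeal e := mem_leftIdeal.2 ⟨a, rfl⟩

theorem mul_mem_rightIdeal (e a : R) : e * a ∈ rightIdeal e := mem_rightIdeal.2 ⟨a, rfl⟩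

theorem self_mem_leftIdeal (e : R) : e ∈ leftIdeal e := Submodule.mem_span_singleton_self e

theorem self_mem_rightIdeal (e : R) : e ∈ rightIdeal e := Submodule.mem_span_singleton_self e

theorem leftIdeal_le {e : R} {U : Submodule R R} : leftIdeal e ≤ U ↔ e ∈ U :=
  Submodule.span_singleton_le_iff_mem _ _

theorem rightIdeal_le {e : R} {A : Submodule Rᵐᵒᵖ R} : rightIdeal e ≤ A ↔ e ∈ A :=
  Submodule.span_singleton_le_iff_mem _ _

theorem mul_mem_left_submodule (U : Submodule R R) (a : R) {x : R} (hx : x ∈ U) : a * x ∈ U :=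
  U.smul_mem a hx

theorem mul_mem_right_submodule (A : Submodule Rᵐᵒᵖ R) {x : R} (hx : x ∈ A) (a : R) :
    x * a ∈ A :=
  A.smul_mem (MulOpposite.op a) hx

theorem mem_leftIdeal_iff_mul_eq {e x : R} (he : IsIdempotentElem e) :
    x ∈ leftIdeal e ↔ x * e = x := by
  rw [mem_leftIdeal]
  refine ⟨?_, fun h => ⟨x, h⟩⟩
  rintro ⟨a, rfl⟩
  rw [mul_assoc, he.eq]

theorem mem_rightIdeal_iff_mul_eq {e x : R} (he : IsIdempotentElem e) :
    x ∈ rightIdeal e ↔ e * x = x := by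
  rw [mem_rightIdeal]
  refine ⟨?_, fun h => ⟨x, h⟩⟩
  rintro ⟨a, rfl⟩
  rw [← mul_assoc, he.eq]

/-- The geometric series for the inverse of `1 - a * b` regroups to `1 + a * u⁻¹ * b`. This is the
source of the left-right symmetry of the graded radical. -/
theorem isUnit_one_sub_mul_of_swap {a b : R} (h : IsUnit (1 - b * a)) : IsUnit (1 - a * b) := by
  obtain ⟨u, hu⟩ := h
  have h1 : (↑u⁻¹ : R) * (1 - b * a) = 1 := by rw [← hu]; simp
  have h2 : (1 - b * a) * (↑u⁻¹ : R) = 1 := by rw [← hu]; simp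
  refine isUnit_iff_exists.2 ⟨1 + a * ↑u⁻¹ * b, ?_, ?_⟩
  · calc (1 - a * b) * (1 + a * ↑u⁻¹ * b)
        = 1 - a * b + a * ((1 - b * a) * ↑u⁻¹) * b := by noncomm_ring
      _ = 1 := by rw [h2]; noncomm_ring
  · calc (1 + a * ↑u⁻¹ * b) * (1 - a * b)
        = 1 - a * b + a * (↑u⁻¹ * (1 - b * a)) * b := by noncomm_ring
      _ = 1 := by rw [h1]; noncomm_ring

variable [AddGroup G] [DecidableEq G] {𝒜 : G → AddSubgroup R} [GradedRing 𝒜]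

theorem decompose_mul_of_left_mem {a b : R} {i : G} (ha : a ∈ 𝒜 i) (k : G) :
    (decompose 𝒜 (a * b) k : R) = a * decompose 𝒜 b (-i + k) := by
  rw [← coe_decompose_mul_add_of_left_mem 𝒜 ha, add_neg_cancel_left]

theorem decompose_mul_of_right_mem {a b : R} {j : G} (hb : b ∈ 𝒜 j) (k : G) :
    (decompose 𝒜 (a * b) k : R) = decompose 𝒜 a (k - j) * b := by
  rw [← coe_decompose_mul_add_of_right_mem 𝒜 hb, sub_add_cancel]

theorem mul_mem_of_add_eq {a b : R} {i j k : G} (ha : a ∈ 𝒜 i) (hb : b ∈ 𝒜 j) (h : i + j = k) :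
    a * b ∈ 𝒜 k := h ▸ SetLike.mul_mem_graded ha hb

theorem isHomogeneous_leftIdeal {x : R} {g : G} (hx : x ∈ 𝒜 g) :
    (leftIdeal x).IsHomogeneous 𝒜 := by
  intro h z hz
  obtain ⟨a, rfl⟩ := mem_leftIdeal.1 hz
  rw [decompose_mul_of_right_mem hx]
  exact mul_mem_leftIdeal _ _

theorem isHomogeneous_rightIdeal {x : R} {g : G} (hx : x ∈ 𝒜 g) :
    (rightIdeal x).IsHomogeneous 𝒜 := by
  intro h z hz
  obtain ⟨a, rfl⟩ := mem_rightIdeal.1 hz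
  rw [decompose_mul_of_left_mem hx]
  exact mul_mem_rightIdeal _ _

theorem exists_homogeneous_left_factor {x z : R} {g h : G} (hx : x ∈ 𝒜 g) (hz : z ∈ 𝒜 h)
    (hzx : z ∈ leftIdeal x) : ∃ a ∈ 𝒜 (h - g), a * x = z := by
  obtain ⟨a, rfl⟩ := mem_leftIdeal.1 hzx
  refine ⟨_, SetLike.coe_mem (decompose 𝒜 a (h - g)), ?_⟩
  rw [← decompose_mul_of_right_mem hx, decompose_of_mem_same 𝒜 hz]

theorem exists_homogeneous_right_factor {x z : R} {g h : G} (hx : x ∈ 𝒜 g) (hz : z ∈ 𝒜 h)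
    (hzx : z ∈ rightIdeal x) : ∃ a ∈ 𝒜 (-g + h), x * a = z := by
  obtain ⟨a, rfl⟩ := mem_rightIdeal.1 hzx
  refine ⟨_, SetLike.coe_mem (decompose 𝒜 a (-g + h)), ?_⟩
  rw [← decompose_mul_of_left_mem hx, decompose_of_mem_same 𝒜 hz]

/-! ### The graded Jacobson radical -/

theorem isHomogeneous_gradedJacobson : (gradedJacobson 𝒜).IsHomogeneous 𝒜 :=
  isHomogeneous_sInf fun _ h => h.homogeneous

theorem exists_isGradedMaximal_ge {U : Submodule R R} (hU : U.IsHomogeneous 𝒜) (h : U ≠ ⊤) :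
    ∃ K, IsGradedMaximal 𝒜 K ∧ U ≤ K := by
  have key : ∃ K, U ≤ K ∧
      Maximal (fun K => K ∈ {K : Submodule R R | K.IsHomogeneous 𝒜 ∧ (1 : R) ∉ K}) K := by
    refine zorn_le_nonempty₀ _ ?_ U ⟨hU, fun h1 => h ((Ideal.eq_top_iff_one U).2 h1)⟩
    intro c hc hchain y hy
    have hmem : ∀ {x : R}, x ∈ sSup c ↔ ∃ K ∈ c, x ∈ K := fun {x} =>
      Submodule.mem_sSup_of_directed ⟨y, hy⟩ hchain.directedOn
    refine ⟨sSup c, ⟨?_, ?_⟩, fun z hz => le_sSup hz⟩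
    · intro g x hx
      obtain ⟨K, hK, hxK⟩ := hmem.1 hx
      exact hmem.2 ⟨K, hK, (hc hK).1 g hxK⟩
    · intro h1
      obtain ⟨K, hK, hxK⟩ := hmem.1 h1
      exact (hc hK).2 hxK
  obtain ⟨K, hUK, hK⟩ := key
  refine ⟨K, ⟨hK.prop.1, fun ht => hK.prop.2 (ht ▸ trivial), fun q hq hlt => ?_⟩, hUK⟩
  by_contra hne
  exact hlt.not_ge (hK.le_of_ge ⟨hq, fun h1 => hne ((Ideal.eq_top_iff_one q).2 h1)⟩ hlt.le)

theorem exists_mul_one_sub_eq_one {c : R} (hc : c ∈ 𝒜 0) (hcJ : c ∈ gradedJacobson 𝒜) :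
    ∃ u ∈ 𝒜 0, u * (1 - c) = 1 := by
  have h1 : (1 - c) ∈ 𝒜 0 := sub_mem SetLike.GradedOne.one_mem hc
  have : leftIdeal (1 - c) = ⊤ := by
    by_contra hne
    obtain ⟨K, hK, hle⟩ := exists_isGradedMaximal_ge (isHomogeneous_leftIdeal h1) hne
    have hcK : c ∈ K := Submodule.mem_sInf.1 hcJ K hK
    have := K.add_mem (hle (self_mem_leftIdeal _)) hcK
    rw [sub_add_cancel] at this
    exact hK.ne_top ((Ideal.eq_top_iff_one K).2 this)
  obtain ⟨u, hu, h⟩ := exists_homogeneous_left_factor h1 (SetLike.GradedOne.one_mem (A := 𝒜))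
    (this ▸ trivial : (1 : R) ∈ leftIdeal (1 - c))
  rw [sub_zero] at hu
  exact ⟨u, hu, h⟩

/-- A left inverse `u` of `1 - c` equals `1 + u * c`, again one minus a radical element of degree
zero, so `u` has a left inverse as well, which must be `1 - c`. -/
theorem isUnit_one_sub_of_mem {c : R} (hc : c ∈ 𝒜 0) (hcJ : c ∈ gradedJacobson 𝒜) :
    IsUnit (1 - c) := by
  obtain ⟨u, hu, h⟩ := exists_mul_one_sub_eq_one hc hcJ
  have huc : -(u * c) ∈ 𝒜 0 := neg_mem (mul_mem_of_add_eq hu hc (add_zero 0))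
  obtain ⟨v, -, hv⟩ := exists_mul_one_sub_eq_one huc
    (neg_mem (mul_mem_left_submodule _ _ hcJ))
  have hu' : 1 - -(u * c) = u := by
    rw [mul_sub, mul_one] at h
    rw [sub_neg_eq_add, ← h]
    abel
  rw [hu'] at hv
  have hv' : v = 1 - c := left_inv_eq_right_inv hv h
  exact isUnit_iff_exists.2 ⟨u, hv' ▸ hv, h⟩

/-- For the converse, a maximal graded `K` missing `a` gives `1 = k + r * a`, whose degree-zero part
puts a unit into `K`. -/
theorem mem_gradedJacobson_iff_left {a : R} {g : G} (ha : a ∈ 𝒜 g) :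
    a ∈ gradedJacobson 𝒜 ↔ ∀ r ∈ 𝒜 (-g), IsUnit (1 - r * a) := by
  refine ⟨fun haJ r hr => isUnit_one_sub_of_mem (mul_mem_of_add_eq hr ha (neg_add_cancel g))
    (mul_mem_left_submodule _ _ haJ), fun h => ?_⟩
  refine Submodule.mem_sInf.2 fun K hK => ?_
  by_contra haK
  have htop : K ⊔ leftIdeal a = ⊤ :=
    hK.eq_top _ (isHomogeneous_sup hK.homogeneous (isHomogeneous_leftIdeal ha))
      (lt_of_le_of_ne le_sup_left fun heq => haK
        (heq ▸ (le_sup_right : leftIdeal a ≤ K ⊔ leftIdeal a) (self_mem_leftIdeal a)))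
  obtain ⟨k, hk, z, hz, hkz⟩ := Submodule.mem_sup.1 (htop ▸ trivial : (1 : R) ∈ K ⊔ leftIdeal a)
  obtain ⟨r, rfl⟩ := mem_leftIdeal.1 hz
  have hk0 := hK.homogeneous 0 hk
  have e1 : (decompose 𝒜 k 0 : R) = 1 - decompose 𝒜 r (-g) * a := by
    have : k = 1 - r * a := eq_sub_of_add_eq hkz
    rw [this, decompose_sub, DirectSum.sub_apply, AddSubgroup.coe_sub,
      decompose_mul_of_right_mem ha, zero_sub,
      decompose_of_mem_same 𝒜 SetLike.GradedOne.one_mem]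
  obtain ⟨u, hu⟩ := h _ (SetLike.coe_mem (decompose 𝒜 r (-g)))
  rw [e1, ← hu] at hk0
  refine hK.ne_top ((Ideal.eq_top_iff_one K).2 ?_)
  have := mul_mem_left_submodule K (↑u⁻¹) hk0
  rwa [Units.inv_mul] at this

theorem mem_gradedJacobson_iff_right {a : R} {g : G} (ha : a ∈ 𝒜 g) :
    a ∈ gradedJacobson 𝒜 ↔ ∀ r ∈ 𝒜 (-g), IsUnit (1 - a * r) :=
  (mem_gradedJacobson_iff_left ha).trans
    ⟨fun h r hr => isUnit_one_sub_mul_of_swap (h r hr),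
      fun h r hr => isUnit_one_sub_mul_of_swap (h r hr)⟩

/-- The right-hand unit criterion absorbs a homogeneous right factor into `r`; additivity in both
arguments does the rest. -/
theorem mul_mem_gradedJacobson {x : R} (hx : x ∈ gradedJacobson 𝒜) (b : R) :
    x * b ∈ gradedJacobson 𝒜 := by
  have key : ∀ g h, ∀ a ∈ 𝒜 g, ∀ c ∈ 𝒜 h, a ∈ gradedJacobson 𝒜 → a * c ∈ gradedJacobson 𝒜 := by
    intro g h a ha c hc haJ
    rw [mem_gradedJacobson_iff_right (SetLike.mul_mem_graded ha hc)]
    intro r hr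
    rw [mul_assoc]
    exact (mem_gradedJacobson_iff_right ha).1 haJ _
      (mul_mem_of_add_eq hc hr (by rw [neg_add_rev, add_neg_cancel_left]))
  refine mem_of_components_mem (ℳ := 𝒜)
    ((gradedJacobson 𝒜).toAddSubgroup.comap (AddMonoidHom.mulLeft x)) fun h => ?_
  refine mem_of_components_mem (ℳ := 𝒜)
    ((gradedJacobson 𝒜).toAddSubgroup.comap (AddMonoidHom.mulRight _)) fun g => ?_
  exact key g h _ (SetLike.coe_mem _) _ (SetLike.coe_mem _) (isHomogeneous_gradedJacobson g hx)

/-- The left ideals generated by the powers of `c` stabilise, so `c ^ n = r * c ^ (n + 1)` with `r`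
of degree zero, and the unit `1 - r * c` kills `c ^ n`. -/
theorem isNilpotent_of_mem_gradedJacobson (hA : IsGradedArtinian R 𝒜) {c : R} (hc : c ∈ 𝒜 0)
    (hcJ : c ∈ gradedJacobson 𝒜) : IsNilpotent c := by
  have hpow : ∀ n : ℕ, c ^ n ∈ 𝒜 0 := fun n => by
    simpa using SetLike.pow_mem_graded n hc
  let f : ℕ → {p : Submodule R R // p.IsHomogeneous 𝒜} := fun n =>
    ⟨leftIdeal (c ^ n), isHomogeneous_leftIdeal (hpow n)⟩
  obtain ⟨_, ⟨n, rfl⟩, hn⟩ := hA.wf.has_min (Set.range f) ⟨_, ⟨0, rfl⟩⟩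
  have hle : f (n + 1) ≤ f n := leftIdeal_le.2 (by rw [pow_succ']; exact mul_mem_leftIdeal _ _)
  have heq : leftIdeal (c ^ (n + 1)) = leftIdeal (c ^ n) :=
    congrArg Subtype.val (eq_of_le_of_not_lt hle (hn _ ⟨n + 1, rfl⟩))
  obtain ⟨r, hr, h⟩ := exists_homogeneous_left_factor (hpow (n + 1)) (hpow n)
    (heq ▸ self_mem_leftIdeal _)
  rw [sub_zero] at hr
  obtain ⟨u, hu⟩ := isUnit_one_sub_of_mem (mul_mem_of_add_eq hr hc (add_zero 0))
    (mul_mem_left_submodule _ r hcJ)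
  refine ⟨n, ?_⟩
  have : (u : R) * c ^ n = 0 := by
    rw [hu, sub_mul, one_mul, mul_assoc, ← pow_succ', h, sub_self]
  simpa using this

end Rings

/-! ### Primitive idempotents of degree zero. -/

section Idempotents

variable {G R : Type*} [Ring R] [AddGroup G] [DecidableEq G] {𝒜 : G → AddSubgroup R}
  [GradedRing 𝒜]

variable (𝒜) in
/-- A nonzero idempotent of degree zero which is not the sum of two nonzero orthogonal idempotents
of degree zero. -/
structure IsPrimitiveIdempotent (e : R) : Prop where
  mem_zero : e ∈ 𝒜 0
  idem : IsIdempotentElem e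
  ne_zero : e ≠ 0
  eq_zero_or_eq : ∀ f ∈ 𝒜 0, IsIdempotentElem f → e * f = f → f * e = f → f = 0 ∨ f = e

/-- Take `N ≤ M` minimal among graded left ideals outside the radical J and a maximal `K` not
containing `N`; minimality gives `N ⊓ K ≤ J`. Writing `1` in `K ⊔ N` yields a degree-zero `n` in `N`
with `n - n ^ 2` in J, hence nilpotent, and `n` is lifted to an idempotent. -/
theorem exists_idempotent_mem (hA : IsGradedArtinian R 𝒜) {M : Submodule R R}
    (hM : M.IsHomogeneous 𝒜) (hMJ : ¬ M ≤ gradedJacobson 𝒜) :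
    ∃ f ∈ M, f ∈ 𝒜 0 ∧ IsIdempotentElem f ∧ f ≠ 0 := by
  obtain ⟨⟨N, hN⟩, ⟨hNM, hNJ⟩, hmin⟩ := hA.wf.has_min
    {p : {p : Submodule R R // p.IsHomogeneous 𝒜} | p.1 ≤ M ∧ ¬ p.1 ≤ gradedJacobson 𝒜}
    ⟨⟨M, hM⟩, le_rfl, hMJ⟩
  have : ∃ K, IsGradedMaximal 𝒜 K ∧ ¬ N ≤ K := by
    by_contra! hc
    exact hNJ (le_sInf hc)
  obtain ⟨K, hK, hNK⟩ := this
  have hinf : N ⊓ K ≤ gradedJacobson 𝒜 := by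
    by_contra hc
    exact hmin ⟨N ⊓ K, isHomogeneous_inf hN hK.homogeneous⟩ ⟨inf_le_left.trans hNM, hc⟩
      (lt_of_le_of_ne (show N ⊓ K ≤ N from inf_le_left)
        fun h => hNK (inf_eq_left.1 (congrArg Subtype.val h)))
  have htop : K ⊔ N = ⊤ := hK.eq_top _ (isHomogeneous_sup hK.homogeneous hN)
    (lt_of_le_of_ne le_sup_left fun h => hNK (h ▸ le_sup_right))
  obtain ⟨k', hk', n', hn', hkn'⟩ := Submodule.mem_sup.1 (htop ▸ trivial : (1 : R) ∈ K ⊔ N)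
  have hn : (decompose 𝒜 n' 0 : R) ∈ N := hN 0 hn'
  have hk : 1 - (decompose 𝒜 n' 0 : R) ∈ K := by
    have h := hK.homogeneous 0 hk'
    rwa [eq_sub_of_add_eq hkn', decompose_sub, DirectSum.sub_apply, AddSubgroup.coe_sub,
      decompose_of_mem_same 𝒜 SetLike.GradedOne.one_mem] at h
  have hn0 : (decompose 𝒜 n' 0 : R) ∈ 𝒜 0 := SetLike.coe_mem _
  generalize (decompose 𝒜 n' 0 : R) = n at hn hk hn0
  have hnn : n - n ^ 2 ∈ gradedJacobson 𝒜 := by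
    refine hinf ⟨?_, ?_⟩
    · rw [pow_two]
      exact N.sub_mem hn (mul_mem_left_submodule N n hn)
    · have := mul_mem_left_submodule K n hk
      rwa [mul_sub, mul_one, ← pow_two] at this
  have hpow : ∀ m : ℕ, n ^ m ∈ 𝒜 0 := fun m => by simpa using SetLike.pow_mem_graded m hn0
  obtain ⟨m, hm⟩ := isNilpotent_of_mem_gradedJacobson hA (sub_mem hn0 (hpow 2)) hnn
  -- The exponent is raised to `m + 1` to be positive: the lifted idempotent is then a left multiple
  -- of `n`, so lies in `N`, and is congruent to `1` modulo `K`, so is nonzero.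
  have hm1 : (n - n ^ 2) ^ (m + 1) = 0 := by rw [pow_succ, hm, zero_mul]
  have h1n : 1 - n ^ (m + 1) ∈ 𝒜 0 := sub_mem SetLike.GradedOne.one_mem (hpow _)
  have hgeom : (1 - n ^ (m + 1)) ∈ K := by
    rw [← geom_sum_mul_neg]
    exact mul_mem_left_submodule K _ hk
  have hgeomN : 1 - (1 - n ^ (m + 1)) ^ (m + 1) ∈ N := by
    rw [← geom_sum_mul_neg, sub_sub_cancel, pow_succ n]
    exact mul_mem_left_submodule N _ (mul_mem_left_submodule N _ hn)
  refine ⟨1 - (1 - n ^ (m + 1)) ^ (m + 1), hNM hgeomN, ?_,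
    isIdempotentElem_one_sub_one_sub_pow_pow n _ hm1, fun h0 => ?_⟩
  · refine sub_mem SetLike.GradedOne.one_mem ?_
    simpa using SetLike.pow_mem_graded (m + 1) h1n
  · refine hK.ne_top ((Ideal.eq_top_iff_one K).2 ?_)
    rw [sub_eq_zero.1 h0, pow_succ]
    exact mul_mem_left_submodule K _ hgeom

/-- `Re` is graded local: an idempotent `f` in `M` makes `e * f` an idempotent below `e`, nonzero
because `f = f * (e * f)`. -/
theorem IsPrimitiveIdempotent.mem_of_not_le (hA : IsGradedArtinian R 𝒜) {e : R}
    (he : IsPrimitiveIdempotent 𝒜 e) {M : Submodule R R} (hM : M.IsHomogeneous 𝒜)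
    (hMe : M ≤ leftIdeal e) (hMJ : ¬ M ≤ gradedJacobson 𝒜) : e ∈ M := by
  obtain ⟨f, hfM, hf0, hf, hfne⟩ := exists_idempotent_mem hA hM hMJ
  have hfe : f * e = f := (mem_leftIdeal_iff_mul_eq he.idem).1 (hMe hfM)
  have hef : IsIdempotentElem (e * f) := by
    rw [IsIdempotentElem, mul_assoc, ← mul_assoc f, hfe, hf.eq]
  have h := he.eq_zero_or_eq (e * f) (mul_mem_of_add_eq he.mem_zero hf0 (add_zero 0)) hef
    (by rw [← mul_assoc, he.idem.eq]) (by rw [mul_assoc, hfe])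
  rcases h with h | h
  · refine absurd ?_ hfne
    rw [← hf.eq, ← hfe, mul_assoc, hfe, h, mul_zero]
  · rw [← h]
    exact mul_mem_left_submodule M e hfM

theorem IsPrimitiveIdempotent.exists_left_inv (hA : IsGradedArtinian R 𝒜) {e : R}
    (he : IsPrimitiveIdempotent 𝒜 e) {a : R} {g : G} (ha : a ∈ 𝒜 g) (hae : a * e = a)
    (haJ : a ∉ gradedJacobson 𝒜) : ∃ b ∈ 𝒜 (-g), b * a = e := by
  have h := he.mem_of_not_le hA (isHomogeneous_leftIdeal ha)
    (leftIdeal_le.2 ((mem_leftIdeal_iff_mul_eq he.idem).2 hae))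
    (fun h => haJ (h (self_mem_leftIdeal a)))
  simpa using exists_homogeneous_left_factor ha he.mem_zero h

/-- The product `a * b` is an idempotent below the primitive `e'`, and if it vanished then `e = b *
a * b * a` would vanish too. -/
theorem IsPrimitiveIdempotent.mul_comm_of_mul_eq {e e' a b : R} (he : IsIdempotentElem e)
    (he0 : e ≠ 0) (he' : IsPrimitiveIdempotent 𝒜 e')
    (hba : b * a = e) (ha : e' * a = a) (hb : b * e' = b) {g : G} (ha0 : a ∈ 𝒜 g)
    (hb0 : b ∈ 𝒜 (-g)) (hae : a * e = a) : a * b = e' := by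
  rcases he'.eq_zero_or_eq (a * b) (mul_mem_of_add_eq ha0 hb0 (add_neg_cancel g))
    (by rw [IsIdempotentElem, mul_assoc, ← mul_assoc b, hba, ← mul_assoc, hae])
    (by rw [← mul_assoc, ha]) (by rw [mul_assoc, hb]) with h | h
  · refine absurd ?_ he0
    rw [← he.eq, ← hba, mul_assoc, ← mul_assoc a, h, zero_mul, mul_zero]
  · exact h

/-- Some `1 - a * r` is not a unit, so by the swap `a * r * e` lies outside the radical. It has a
left inverse inside `eRe`, which is two-sided by primitivity; thus the left chain condition
suffices. -/
theorem IsPrimitiveIdempotent.exists_right_inv (hA : IsGradedArtinian R 𝒜) {e : R}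
    (he : IsPrimitiveIdempotent 𝒜 e) {a : R} {g : G} (ha : a ∈ 𝒜 g) (hea : e * a = a)
    (haJ : a ∉ gradedJacobson 𝒜) : ∃ b ∈ 𝒜 (-g), a * b = e := by
  rw [mem_gradedJacobson_iff_right ha] at haJ
  push Not at haJ
  obtain ⟨r, hr, hru⟩ := haJ
  have har : a * r ∈ 𝒜 0 := mul_mem_of_add_eq ha hr (add_neg_cancel g)
  have hre : a * r * e ∉ gradedJacobson 𝒜 := by
    intro hJ
    refine hru ?_
    have := isUnit_one_sub_mul_of_swap
      (isUnit_one_sub_of_mem (mul_mem_of_add_eq har he.mem_zero (add_zero 0)) hJ)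
    rwa [← mul_assoc, hea] at this
  obtain ⟨b, hb, hbe⟩ := he.exists_left_inv hA (mul_mem_of_add_eq har he.mem_zero (add_zero 0))
    (by rw [mul_assoc, he.idem.eq]) hre
  rw [neg_zero] at hb
  have h := IsPrimitiveIdempotent.mul_comm_of_mul_eq (a := a * r * e) (b := b * e) (g := (0 : G))
    he.idem he.ne_zero he
    (by rw [mul_assoc b, ← mul_assoc e, ← mul_assoc e, hea, hbe])
    (by rw [← mul_assoc, ← mul_assoc, hea]) (by rw [mul_assoc, he.idem.eq])
    (mul_mem_of_add_eq har he.mem_zero (add_zero 0))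
    (mul_mem_of_add_eq hb he.mem_zero (by simp)) (by rw [mul_assoc, he.idem.eq])
  refine ⟨r * e * (b * e), ?_, by simpa only [mul_assoc] using h⟩
  exact mul_mem_of_add_eq (mul_mem_of_add_eq hr he.mem_zero (add_zero _))
    (mul_mem_of_add_eq hb he.mem_zero (add_zero 0)) (add_zero _)

theorem IsPrimitiveIdempotent.notMem_gradedJacobson (hA : IsGradedArtinian R 𝒜) {e : R}
    (he : IsPrimitiveIdempotent 𝒜 e) : e ∉ gradedJacobson 𝒜 := by
  intro h
  obtain ⟨n, hn⟩ := isNilpotent_of_mem_gradedJacobson hA he.mem_zero h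
  have : e ^ (n + 1) = 0 := by rw [pow_succ, hn, zero_mul]
  rw [he.idem.pow_succ_eq] at this
  exact he.ne_zero this

/-- An intermediate idempotent `f` would split `Re` as `Rf ⊕ R(e - f)`. -/
theorem isPrimitiveIdempotent_of_indecomposable {e : R} (h0 : e ∈ 𝒜 0) (he : IsIdempotentElem e)
    (h : IsGradedIndecomposable 𝒜 (leftIdeal e)) : IsPrimitiveIdempotent 𝒜 e := by
  refine ⟨h0, he, fun h0 => h.ne_bot (by simp [leftIdeal, h0]), fun f hf0 hf hef hfe => ?_⟩
  have := h.eq_bot_or_eq_bot (leftIdeal f) (leftIdeal (e - f)) (isHomogeneous_leftIdeal hf0)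
    (isHomogeneous_leftIdeal (sub_mem h0 hf0)) ?_ ?_
  · rcases this with h | h
    · exact Or.inl (by simpa [leftIdeal] using h)
    · exact Or.inr (sub_eq_zero.1 (by simpa [leftIdeal] using h)).symm
  · refine eq_bot_iff.2 fun x hx => ?_
    have h1 : x * f = x := (mem_leftIdeal_iff_mul_eq hf).1 hx.1
    obtain ⟨a, rfl⟩ := mem_leftIdeal.1 hx.2
    rw [← h1, mul_assoc, sub_mul, hef, hf.eq, sub_self, mul_zero]
    exact zero_mem _
  · refine le_antisymm (sup_le (leftIdeal_le.2 (mem_leftIdeal.2 ⟨f, hfe⟩)) (leftIdeal_le.2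
      (Submodule.sub_mem _ (self_mem_leftIdeal e) (mem_leftIdeal.2 ⟨f, hfe⟩)))) (leftIdeal_le.2 ?_)
    have := Submodule.add_mem_sup (self_mem_leftIdeal f) (self_mem_leftIdeal (e - f))
    rwa [add_sub_cancel] at this

/-- The degree-zero parts of the two components of `e` along a graded decomposition are orthogonal
idempotents with sum `e`. -/
theorem IsPrimitiveIdempotent.isGradedIndecomposable {e : R} (he : IsPrimitiveIdempotent 𝒜 e) :
    IsGradedIndecomposable 𝒜 (leftIdeal e) := by
  refine ⟨isHomogeneous_leftIdeal he.mem_zero, fun h => he.ne_zero (by simpa [leftIdeal] using h),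
    fun a b ha hb hinf hsup => ?_⟩
  obtain ⟨x', hx', y', hy', hxy'⟩ := Submodule.mem_sup.1 (hsup ▸ self_mem_leftIdeal e : e ∈ a ⊔ b)
  have hx : (decompose 𝒜 x' 0 : R) ∈ a := ha 0 hx'
  have hy : (decompose 𝒜 y' 0 : R) ∈ b := hb 0 hy'
  have hxy : (decompose 𝒜 x' 0 : R) + decompose 𝒜 y' 0 = e := by
    rw [← AddSubgroup.coe_add, ← DirectSum.add_apply, ← decompose_add, hxy',
      decompose_of_mem_same 𝒜 he.mem_zero]
  have hx0 : (decompose 𝒜 x' 0 : R) ∈ 𝒜 0 := SetLike.coe_mem _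
  generalize (decompose 𝒜 x' 0 : R) = x at hx hxy hx0
  generalize (decompose 𝒜 y' 0 : R) = y at hy hxy
  have hxe : x * e = x :=
    (mem_leftIdeal_iff_mul_eq he.idem).1 (hsup ▸ Submodule.mem_sup_left hx)
  have hye : y * e = y :=
    (mem_leftIdeal_iff_mul_eq he.idem).1 (hsup ▸ Submodule.mem_sup_right hy)
  have hbot : ∀ z, z ∈ a → z ∈ b → z = 0 := fun z h1 h2 => by
    have : z ∈ a ⊓ b := ⟨h1, h2⟩
    rwa [hinf, Submodule.mem_bot] at this
  have hxy0 : x * y = 0 := by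
    refine hbot _ ?_ (mul_mem_left_submodule b x hy)
    have : x * y = x - x * x := by
      rw [eq_sub_iff_add_eq', ← mul_add, hxy, hxe]
    rw [this]
    exact a.sub_mem hx (mul_mem_left_submodule a x hx)
  have hyx0 : y * x = 0 := by
    refine hbot _ (mul_mem_left_submodule a y hx) ?_
    have : y * x = y - y * y := by
      rw [eq_sub_iff_add_eq, ← mul_add, hxy, hye]
    rw [this]
    exact b.sub_mem hy (mul_mem_left_submodule b y hy)
  have hxx : x * x = x := by
    rw [← hxy, mul_add, hxy0, add_zero] at hxe
    exact hxe
  rcases he.eq_zero_or_eq x hx0 hxx (by rw [← hxy, add_mul, hyx0, add_zero, hxx]) hxe with h | h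
  · left
    rw [h, zero_add] at hxy
    have : b = leftIdeal e :=
      le_antisymm (hsup ▸ le_sup_right) (leftIdeal_le.2 (hxy ▸ hy))
    rw [← hinf, eq_comm, inf_eq_left, this]
    exact hsup ▸ le_sup_left
  · right
    have : a = leftIdeal e :=
      le_antisymm (hsup ▸ le_sup_left) (leftIdeal_le.2 (h ▸ hx))
    rw [← hinf, eq_comm, inf_eq_right, this]
    exact hsup ▸ le_sup_right

/-- Every idempotent of degree zero of a graded left Artinian ring is a finite sum of orthogonal
primitive idempotents. -/
theorem exists_orthogonal_primitive (hA : IsGradedArtinian R 𝒜) {e : R} (he0 : e ∈ 𝒜 0)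
    (he : IsIdempotentElem e) :
    ∃ (n : ℕ) (f : Fin n → R), OrthogonalIdempotents f ∧ (∀ k, IsPrimitiveIdempotent 𝒜 (f k)) ∧
      (∀ k, e * f k = f k) ∧ (∀ k, f k * e = f k) ∧ ∑ k, f k = e := by
  -- Induction on the left ideal `Re`: when `e` splits as `f + (e - f)`, both summands generate
  -- strictly smaller left ideals.
  suffices H : ∀ p : {p : Submodule R R // p.IsHomogeneous 𝒜}, ∀ e ∈ 𝒜 0, IsIdempotentElem e →
      leftIdeal e = p.1 → ∃ (n : ℕ) (f : Fin n → R), OrthogonalIdempotents f ∧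
        (∀ k, IsPrimitiveIdempotent 𝒜 (f k)) ∧
        (∀ k, e * f k = f k) ∧ (∀ k, f k * e = f k) ∧ ∑ k, f k = e from
    H ⟨_, isHomogeneous_leftIdeal he0⟩ e he0 he rfl
  intro p
  induction p using hA.wf.induction with
  | _ p ih =>
  intro e he0 he hep
  by_cases hz : e = 0
  · exact ⟨0, Fin.elim0, ⟨fun i => i.elim0, fun i => i.elim0⟩, fun i => i.elim0,
      fun i => i.elim0, fun i => i.elim0, by simp [hz]⟩
  by_cases hp : IsPrimitiveIdempotent 𝒜 e
  · exact ⟨1, fun _ => e, ⟨fun _ => he, fun i j hij => absurd (Subsingleton.elim i j) hij⟩,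
      fun _ => hp, fun _ => he.eq, fun _ => he.eq, by simp⟩
  have : ∃ f ∈ 𝒜 0, IsIdempotentElem f ∧ e * f = f ∧ f * e = f ∧ f ≠ 0 ∧ f ≠ e := by
    by_contra! hc
    refine hp ⟨he0, he, hz, fun f hf0 hf h1 h2 => ?_⟩
    by_cases h : f = 0
    · exact Or.inl h
    · exact Or.inr (hc f hf0 hf h1 h2 h)
  obtain ⟨f, hf0, hf, hef, hfe, hfne, hfne'⟩ := this
  have hlt : ∀ f' (hf0' : f' ∈ 𝒜 0), IsIdempotentElem f' → e * f' = f' → f' * e = f' → f' ≠ e →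
      (⟨leftIdeal f', isHomogeneous_leftIdeal hf0'⟩ : {p : Submodule R R // p.IsHomogeneous 𝒜})
        < p := by
    intro f' hf0' hf' h1 h2 h3
    refine lt_of_le_of_ne ?_ fun heq => h3 ?_
    · change leftIdeal f' ≤ p.1
      exact hep ▸ leftIdeal_le.2 (mem_leftIdeal.2 ⟨f', h2⟩)
    · have : e ∈ leftIdeal f' := by
        have h4 : leftIdeal f' = p.1 := congrArg Subtype.val heq
        rw [h4, ← hep]
        exact self_mem_leftIdeal e
      rw [← h1, (mem_leftIdeal_iff_mul_eq hf').1 this]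
  have hg : IsIdempotentElem (e - f) := by
    rw [IsIdempotentElem, mul_sub, sub_mul, sub_mul, he.eq, hfe, hef, hf.eq, sub_self, sub_zero]
  have hg0 : e - f ∈ 𝒜 0 := sub_mem he0 hf0
  have hge : (e - f) * e = e - f := by rw [sub_mul, he.eq, hfe]
  have heg : e * (e - f) = e - f := by rw [mul_sub, he.eq, hef]
  have hfg : f * (e - f) = 0 := by rw [mul_sub, hfe, hf.eq, sub_self]
  have hgf : (e - f) * f = 0 := by rw [sub_mul, hef, hf.eq, sub_self]
  obtain ⟨m, u, hu, hup, hul, hur, hus⟩ := ih _ (hlt f hf0 hf hef hfe hfne') f hf0 hf rfl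
  obtain ⟨n, v, hv, hvp, hvl, hvr, hvs⟩ := ih _ (hlt (e - f) hg0 hg heg hge
    (fun h => hfne (by simpa using h))) (e - f) hg0 hg rfl
  refine ⟨m + n, Fin.append u v, ⟨fun i => ?_, fun i j hij => ?_⟩, fun i => ?_, fun i => ?_,
    fun i => ?_, ?_⟩
  · refine Fin.addCases (fun i => ?_) (fun i => ?_) i <;> simp [hu.idem, hv.idem]
  · refine Fin.addCases (fun i hij => ?_) (fun i hij => ?_) i hij <;>
      refine Fin.addCases (fun j hij => ?_) (fun j hij => ?_) j hij
    · simp only [Fin.append_left]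
      exact hu.ortho (fun h => hij (by rw [h]))
    · simp only [Fin.append_left, Fin.append_right]
      rw [← hur, ← hvl, mul_assoc, ← mul_assoc f, hfg, zero_mul, mul_zero]
    · simp only [Fin.append_left, Fin.append_right]
      rw [← hvr, ← hul, mul_assoc, ← mul_assoc (e - f), hgf, zero_mul, mul_zero]
    · simp only [Fin.append_right]
      exact hv.ortho (fun h => hij (by rw [h]))
  · refine Fin.addCases (fun i => ?_) (fun i => ?_) i <;> simp [hup, hvp]
  · refine Fin.addCases (fun i => ?_) (fun i => ?_) i
    · rw [Fin.append_left, ← hul, ← mul_assoc, hef]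
    · rw [Fin.append_right, ← hvl, ← mul_assoc, heg]
  · refine Fin.addCases (fun i => ?_) (fun i => ?_) i
    · rw [Fin.append_left, ← hur, mul_assoc, hfe]
    · rw [Fin.append_right, ← hvr, mul_assoc, hge]
  · rw [Fin.sum_univ_add]
    simp [hus, hvs]

theorem isInternal_leftIdeal {n : ℕ} {f : Fin n → R} (hf : OrthogonalIdempotents f)
    (hsum : ∑ k, f k = 1) : DirectSum.IsInternal fun k => leftIdeal (f k) := by
  refine isInternal_submodule_of_iSupIndep_of_iSup_eq_top ?_ ?_
  · rw [iSupIndep_def]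
    intro k
    rw [Submodule.disjoint_def]
    intro x hx hx'
    -- Right multiplication by `f k` kills every other summand and is the identity on its own.
    have hle : ⨆ j, ⨆ (_ : j ≠ k), leftIdeal (f j) ≤
        LinearMap.ker (LinearMap.toSpanSingleton R R (f k)) := by
      refine iSup₂_le fun j hj => leftIdeal_le.2 ?_
      rw [LinearMap.mem_ker, LinearMap.toSpanSingleton_apply, smul_eq_mul]
      exact hf.ortho hj
    have h0 := hle hx'
    rw [LinearMap.mem_ker, LinearMap.toSpanSingleton_apply, smul_eq_mul] at h0
    rw [← (mem_leftIdeal_iff_mul_eq (hf.idem k)).1 hx, h0]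
  · refine (Ideal.eq_top_iff_one _).2 ?_
    rw [← hsum]
    exact sum_mem fun k _ => Submodule.mem_iSup_of_mem k (self_mem_leftIdeal _)

/-- If the left ideals generated by two idempotents are isomorphic then `f` factors through `e`. -/
theorem exists_mul_mul_eq_of_linearEquiv {e f : R} (he : IsIdempotentElem e)
    (φ : leftIdeal f ≃ₗ[R] leftIdeal e) : ∃ w v, w * e * v = f := by
  let F : leftIdeal f := ⟨f, self_mem_leftIdeal f⟩
  let E : leftIdeal e := ⟨e, self_mem_leftIdeal e⟩
  refine ⟨(φ F : R), (φ.symm E : R), ?_⟩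
  have h1 : φ F = (φ F : R) • E := Subtype.ext
    ((mem_leftIdeal_iff_mul_eq he).1 (φ F).2).symm
  have h2 : F = (φ F : R) • φ.symm E := by
    rw [← map_smul, ← h1, φ.symm_apply_apply]
  have h3 : f = (φ F : R) * (φ.symm E : R) := congrArg Subtype.val h2
  rw [(mem_leftIdeal_iff_mul_eq he).1 (φ F).2]
  exact h3.symm

/-! ### Representative systems and the ideal they generate. -/

variable {t : ℕ} {e : Fin t → R}

theorem IsRepresentativeSystem.isPrimitiveIdempotent (he : IsRepresentativeSystem 𝒜 e)
    (i : Fin t) : IsPrimitiveIdempotent 𝒜 (e i) := by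
  obtain ⟨n, Q, -, hQ, k, hk⟩ := he.principal i
  exact isPrimitiveIdempotent_of_indecomposable (he.mem_zero i) (he.idempotent i) (hk ▸ hQ k)

/-- Each primitive summand of `1` generates a left ideal isomorphic, up to shift, to some `Re_i`, so
it factors through `e i`. Membership questions can then be tested after multiplication into the `e
i`. -/
theorem IsRepresentativeSystem.one_mem_closure (hA : IsGradedArtinian R 𝒜)
    (he : IsRepresentativeSystem 𝒜 e) :
    (1 : R) ∈ AddSubgroup.closure {z | ∃ i a b, z = a * e i * b} := by
  obtain ⟨n, f, hf, hfp, -, -, hsum⟩ := exists_orthogonal_primitive hA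
    (SetLike.GradedOne.one_mem (A := 𝒜)) IsIdempotentElem.one
  rw [← hsum]
  refine sum_mem fun k _ => AddSubgroup.subset_closure ?_
  obtain ⟨i, σ, φ, -⟩ := he.exhaustive (leftIdeal (f k))
    ⟨n, _, isInternal_leftIdeal hf hsum, fun k => (hfp k).isGradedIndecomposable, k, rfl⟩
  obtain ⟨w, v, h⟩ := exists_mul_mul_eq_of_linearEquiv (he.idempotent i) φ
  exact ⟨i, w, v, h.symm⟩

theorem IsRepresentativeSystem.mem_of_left (hA : IsGradedArtinian R 𝒜)
    (he : IsRepresentativeSystem 𝒜 e) (U : Submodule R R) {x : R}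
    (h : ∀ i g, ∀ b ∈ 𝒜 g, e i * (b * x) ∈ U) : x ∈ U := by
  have h1 : AddSubgroup.closure {z | ∃ i a b, z = a * e i * b} ≤
      U.toAddSubgroup.comap (AddMonoidHom.mulRight x) := by
    rw [AddSubgroup.closure_le]
    rintro _ ⟨i, a, b, rfl⟩
    change a * e i * b * x ∈ U
    rw [mul_assoc, mul_assoc]
    refine mul_mem_left_submodule U a ?_
    exact mem_of_components_mem (ℳ := 𝒜) (U.toAddSubgroup.comap
      ((AddMonoidHom.mulLeft (e i)).comp (AddMonoidHom.mulRight x)))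
      fun g => h i g _ (SetLike.coe_mem _)
  have h2 : 1 * x ∈ U := h1 (he.one_mem_closure hA)
  rwa [one_mul] at h2

theorem IsRepresentativeSystem.mem_of_right (hA : IsGradedArtinian R 𝒜)
    (he : IsRepresentativeSystem 𝒜 e) (U : Submodule Rᵐᵒᵖ R) {x : R}
    (h : ∀ i g, ∀ b ∈ 𝒜 g, x * b * e i ∈ U) : x ∈ U := by
  have h1 : AddSubgroup.closure {z | ∃ i a b, z = a * e i * b} ≤
      U.toAddSubgroup.comap (AddMonoidHom.mulLeft x) := by
    rw [AddSubgroup.closure_le]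
    rintro _ ⟨i, a, b, rfl⟩
    change x * (a * e i * b) ∈ U
    rw [← mul_assoc, ← mul_assoc]
    refine mul_mem_right_submodule U ?_ b
    exact mem_of_components_mem (ℳ := 𝒜) (U.toAddSubgroup.comap
      ((AddMonoidHom.mulRight (e i)).comp (AddMonoidHom.mulLeft x)))
      fun g => h i g _ (SetLike.coe_mem _)
  have h2 : x * 1 ∈ U := h1 (he.one_mem_closure hA)
  rwa [mul_one] at h2

end Idempotents

/-! ### Graded simple submodules and covers. -/

section Simple

variable {G S M : Type*} [Ring S] [AddCommGroup M] [Module S M] [DecidableEq G]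
  {ℳ : G → AddSubgroup M} [DirectSum.Decomposition ℳ]

theorem IsGradedSimple.eq_of_mem {p q : Submodule S M} (hp : IsGradedSimple ℳ p)
    (hq : q.IsHomogeneous ℳ) (hqp : q ≤ p) {x : M} (hx : x ∈ q) (hx0 : x ≠ 0) : q = p :=
  (hp.eq_bot_or_eq q hq hqp).resolve_left fun h => hx0 (by simpa [h] using hx)

theorem exists_isGradedSimple_le (hA : IsGradedArtinian S ℳ) {p : Submodule S M}
    (hp : p.IsHomogeneous ℳ) (hp0 : p ≠ ⊥) : ∃ q ≤ p, IsGradedSimple ℳ q := by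
  obtain ⟨⟨q, hq⟩, ⟨hqp, hq0⟩, hmin⟩ := hA.wf.has_min
    {q : {q : Submodule S M // q.IsHomogeneous ℳ} | q.1 ≤ p ∧ q.1 ≠ ⊥} ⟨⟨p, hp⟩, le_rfl, hp0⟩
  refine ⟨q, hqp, hq, hq0, fun r hr hrq => ?_⟩
  by_contra! hc
  exact hmin ⟨r, hr⟩ ⟨hrq.trans hqp, hc.1⟩ (lt_of_le_of_ne (show r ≤ q from hrq)
    fun h => hc.2 (congrArg Subtype.val h))

theorem forall_between_of_covBy
    {U V : {p : Submodule S M // p.IsHomogeneous ℳ}} (h : U ⋖ V) (C : Submodule S M)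
    (hC : C.IsHomogeneous ℳ) (hUC : U.1 ≤ C) (hCV : C ≤ V.1) : C = U.1 ∨ C = V.1 := by
  have hle : U ≤ ⟨C, hC⟩ := hUC
  rcases h.wcovBy.eq_or_eq hle hCV with h | h
  · exact Or.inl (congrArg Subtype.val h)
  · exact Or.inr (congrArg Subtype.val h)

end Simple

/-! ### Socles as annihilators of the radical. -/

section Socle

variable {G R : Type*} [Ring R] [AddGroup G] [DecidableEq G] {𝒜 : G → AddSubgroup R}
  [GradedRing 𝒜]

variable (𝒜) in
/-- The left ideal of the elements annihilated by the graded Jacobson radical on the left. -/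
def leftSocle : Submodule R R where
  carrier := {x | ∀ c ∈ gradedJacobson 𝒜, c * x = 0}
  add_mem' hx hy c hc := by rw [mul_add, hx c hc, hy c hc, add_zero]
  zero_mem' _ _ := mul_zero _
  smul_mem' r x hx c hc := by
    rw [smul_eq_mul, ← mul_assoc, hx _ (mul_mem_gradedJacobson hc r)]

variable (𝒜) in
/-- The right ideal of the elements annihilated by the graded Jacobson radical on the right. -/
def rightSocle : Submodule Rᵐᵒᵖ R where
  carrier := {x | ∀ c ∈ gradedJacobson 𝒜, x * c = 0}
  add_mem' hx hy c hc := by rw [add_mul, hx c hc, hy c hc, add_zero]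
  zero_mem' _ _ := zero_mul _
  smul_mem' r x hx c hc := by
    rw [← MulOpposite.op_unop r, op_smul_eq_mul, mul_assoc,
      hx _ (mul_mem_left_submodule _ _ hc)]

theorem mul_right_mem_leftSocle {x : R} (hx : x ∈ leftSocle 𝒜) (a : R) : x * a ∈ leftSocle 𝒜 :=
  fun c hc => by rw [← mul_assoc, hx c hc, zero_mul]

theorem mul_left_mem_rightSocle {x : R} (hx : x ∈ rightSocle 𝒜) (a : R) :
    a * x ∈ rightSocle 𝒜 :=
  fun c hc => by rw [mul_assoc, hx c hc, mul_zero]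

theorem mul_eq_zero_of_forall_homogeneous {U : Submodule R R} (hU : U.IsHomogeneous 𝒜) {x : R}
    (h : ∀ g, ∀ c ∈ 𝒜 g, c ∈ U → c * x = 0) : ∀ c ∈ U, c * x = 0 := fun _ hc =>
  mem_of_components_mem (ℳ := 𝒜) (AddMonoidHom.mulRight x).ker
    fun g => h g _ (SetLike.coe_mem _) (hU g hc)

theorem isHomogeneous_rightAnn {U : Submodule R R} (hU : U.IsHomogeneous 𝒜) :
    (rightAnn (U : Set R)).IsHomogeneous 𝒜 := by
  intro h x hx
  refine mul_eq_zero_of_forall_homogeneous hU fun g c hc hcU => ?_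
  have := decompose_mul_of_left_mem (b := x) hc (g + h)
  rw [neg_add_cancel_left] at this
  rw [← this, hx c hcU]
  simp

theorem mul_eq_zero_of_forall_homogeneous_right {A : Submodule Rᵐᵒᵖ R} (hA : A.IsHomogeneous 𝒜)
    {x : R} (h : ∀ g, ∀ c ∈ 𝒜 g, c ∈ A → x * c = 0) : ∀ c ∈ A, x * c = 0 := fun _ hc =>
  mem_of_components_mem (ℳ := 𝒜) (AddMonoidHom.mulLeft x).ker
    fun g => h g _ (SetLike.coe_mem _) (hA g hc)

theorem isHomogeneous_leftAnn {A : Submodule Rᵐᵒᵖ R} (hA : A.IsHomogeneous 𝒜) :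
    (leftAnn (A : Set R)).IsHomogeneous 𝒜 := by
  intro h x hx
  refine mul_eq_zero_of_forall_homogeneous_right hA fun g c hc hcA => ?_
  have := decompose_mul_of_right_mem (a := x) hc (h + g)
  rw [add_sub_cancel_right] at this
  rw [← this, hx c hcA]
  simp

theorem isHomogeneous_leftSocle : (leftSocle 𝒜).IsHomogeneous 𝒜 := fun _ _ hx =>
  isHomogeneous_rightAnn isHomogeneous_gradedJacobson _ hx

theorem isHomogeneous_rightSocle : (rightSocle 𝒜).IsHomogeneous 𝒜 := by
  intro h x hx c hc
  refine mem_of_components_mem (ℳ := 𝒜) (AddMonoidHom.mulLeft _).ker fun g => ?_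
  have := decompose_mul_of_right_mem (a := x) (SetLike.coe_mem (decompose 𝒜 c g)) (h + g)
  rw [add_sub_cancel_right] at this
  change (decompose 𝒜 x h : R) * (decompose 𝒜 c g : R) = 0
  rw [← this, hx _ (isHomogeneous_gradedJacobson g hc)]
  simp

/-- The radical annihilates a graded left module without proper nonzero graded submodules. -/
theorem gradedJacobson_mul_mem {U V : Submodule R R} (hU : U.IsHomogeneous 𝒜)
    (hV : V.IsHomogeneous 𝒜) (hUV : U ≤ V)
    (h : ∀ C : Submodule R R, C.IsHomogeneous 𝒜 → U ≤ C → C ≤ V → C = U ∨ C = V)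
    {a x : R} (ha : a ∈ gradedJacobson 𝒜) (hx : x ∈ V) : a * x ∈ U := by
  have key : ∀ g k, ∀ a ∈ 𝒜 g, ∀ x ∈ 𝒜 k, a ∈ gradedJacobson 𝒜 → x ∈ V → a * x ∈ U := by
    intro g k a ha x hx haJ hxV
    by_contra hax
    have hC : U ⊔ leftIdeal (a * x) = V := by
      refine (h _ (isHomogeneous_sup hU (isHomogeneous_leftIdeal (SetLike.mul_mem_graded ha hx)))
        le_sup_left (sup_le hUV (leftIdeal_le.2 (mul_mem_left_submodule V a hxV)))).resolve_left ?_
      intro h0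
      exact hax (h0 ▸ (le_sup_right : _ ≤ U ⊔ leftIdeal (a * x)) (self_mem_leftIdeal _))
    -- Nakayama's argument: in `x = u + r * (a * x)` the degree-`k` part shows that a unit `1 - r' *
    -- a` carries `x` into `U`, which forces `a * x` into `U`.
    obtain ⟨u, hu, z, hz, hx'⟩ := Submodule.mem_sup.1 (hC ▸ hxV : x ∈ U ⊔ leftIdeal (a * x))
    obtain ⟨r, rfl⟩ := mem_leftIdeal.1 hz
    have huk := hU k hu
    rw [eq_sub_of_add_eq hx', decompose_sub, DirectSum.sub_apply, AddSubgroup.coe_sub,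
      decompose_of_mem_same 𝒜 hx, ← mul_assoc, decompose_mul_of_right_mem hx, sub_self,
      decompose_mul_of_right_mem ha, zero_sub] at huk
    obtain ⟨w, hw⟩ := (mem_gradedJacobson_iff_left ha).1 haJ _
      (SetLike.coe_mem (decompose 𝒜 r (-g)))
    have h1 : (w : R) * x ∈ U := by rwa [hw, sub_mul, one_mul]
    have h2 := mul_mem_left_submodule U (a * ↑w⁻¹) h1
    rw [mul_assoc, Units.inv_mul_cancel_left] at h2
    exact hax h2
  refine mem_of_components_mem (ℳ := 𝒜)
    (U.toAddSubgroup.comap (AddMonoidHom.mulLeft a)) fun k => ?_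
  refine mem_of_components_mem (ℳ := 𝒜)
    (U.toAddSubgroup.comap (AddMonoidHom.mulRight _)) fun g => ?_
  exact key g k _ (SetLike.coe_mem _) _ (SetLike.coe_mem _) (isHomogeneous_gradedJacobson g ha)
    (hV k hx)

/-- The radical annihilates a graded right module without proper nonzero graded submodules. -/
theorem mul_gradedJacobson_mem {U V : Submodule Rᵐᵒᵖ R} (hU : U.IsHomogeneous 𝒜)
    (hV : V.IsHomogeneous 𝒜) (hUV : U ≤ V)
    (h : ∀ C : Submodule Rᵐᵒᵖ R, C.IsHomogeneous 𝒜 → U ≤ C → C ≤ V → C = U ∨ C = V)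
    {a x : R} (ha : a ∈ gradedJacobson 𝒜) (hx : x ∈ V) : x * a ∈ U := by
  have key : ∀ g k, ∀ a ∈ 𝒜 g, ∀ x ∈ 𝒜 k, a ∈ gradedJacobson 𝒜 → x ∈ V → x * a ∈ U := by
    intro g k a ha x hx haJ hxV
    by_contra hax
    have hC : U ⊔ rightIdeal (x * a) = V := by
      refine (h _ (isHomogeneous_sup hU (isHomogeneous_rightIdeal (SetLike.mul_mem_graded hx ha)))
        le_sup_left (sup_le hUV (rightIdeal_le.2 (mul_mem_right_submodule V hxV a)))).resolve_left ?_
      intro h0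
      exact hax (h0 ▸ (le_sup_right : _ ≤ U ⊔ rightIdeal (x * a)) (self_mem_rightIdeal _))
    obtain ⟨u, hu, z, hz, hx'⟩ := Submodule.mem_sup.1 (hC ▸ hxV : x ∈ U ⊔ rightIdeal (x * a))
    obtain ⟨r, rfl⟩ := mem_rightIdeal.1 hz
    have huk := hU k hu
    rw [eq_sub_of_add_eq hx', decompose_sub, DirectSum.sub_apply, AddSubgroup.coe_sub,
      decompose_of_mem_same 𝒜 hx, mul_assoc, decompose_mul_of_left_mem hx, neg_add_cancel,
      decompose_mul_of_left_mem ha, add_zero] at huk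
    obtain ⟨w, hw⟩ := (mem_gradedJacobson_iff_right ha).1 haJ _
      (SetLike.coe_mem (decompose 𝒜 r (-g)))
    have h1 : x * (w : R) ∈ U := by rwa [hw, mul_sub, mul_one]
    have h2 := mul_mem_right_submodule U h1 (↑w⁻¹ * a)
    rw [← mul_assoc, Units.mul_inv_cancel_right] at h2
    exact hax h2
  refine mem_of_components_mem (ℳ := 𝒜)
    (U.toAddSubgroup.comap (AddMonoidHom.mulRight a)) fun k => ?_
  refine mem_of_components_mem (ℳ := 𝒜)
    (U.toAddSubgroup.comap (AddMonoidHom.mulLeft _)) fun g => ?_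
  exact key g k _ (SetLike.coe_mem _) _ (SetLike.coe_mem _) (isHomogeneous_gradedJacobson g ha)
    (hV k hx)

theorem IsGradedSimple.le_leftSocle {q : Submodule R R} (hq : IsGradedSimple 𝒜 q) :
    q ≤ leftSocle 𝒜 := fun x hx c hc => by
  have := gradedJacobson_mul_mem isHomogeneous_bot hq.homogeneous bot_le
    (fun C hC _ h => hq.eq_bot_or_eq C hC h) hc hx
  simpa using this

theorem IsGradedSimple.le_rightSocle {q : Submodule Rᵐᵒᵖ R} (hq : IsGradedSimple 𝒜 q) :
    q ≤ rightSocle 𝒜 := fun x hx c hc => by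
  have := mul_gradedJacobson_mem isHomogeneous_bot hq.homogeneous bot_le
    (fun C hC _ h => hq.eq_bot_or_eq C hC h) hc hx
  simpa using this

/-- A nonzero multiple `a * x = (a * e) * x` has `a * e` outside the radical, since the radical
kills `x`; a left inverse of `a * e` recovers `x`. -/
theorem IsPrimitiveIdempotent.isGradedSimple_leftIdeal (hA : IsGradedArtinian R 𝒜) {e : R}
    (he : IsPrimitiveIdempotent 𝒜 e) {x : R} {g : G} (hx : x ∈ 𝒜 g) (hx0 : x ≠ 0)
    (hex : e * x = x) (hxL : x ∈ leftSocle 𝒜) : IsGradedSimple 𝒜 (leftIdeal x) := by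
  refine ⟨isHomogeneous_leftIdeal hx, fun h => hx0 (by simpa [leftIdeal] using h),
    fun q hq hqx => or_iff_not_imp_left.2 fun hq0 => le_antisymm hqx (leftIdeal_le.2 ?_)⟩
  obtain ⟨h, z, hz, hzq, hz0⟩ := exists_homogeneous_ne_zero hq hq0
  obtain ⟨a, ha, rfl⟩ := exists_homogeneous_left_factor hx hz (hqx hzq)
  have hae : a * e * x = a * x := by rw [mul_assoc, hex]
  obtain ⟨b, -, hb⟩ := he.exists_left_inv hA (mul_mem_of_add_eq ha he.mem_zero (add_zero _))
    (by rw [mul_assoc, he.idem.eq]) (fun haJ => hz0 (by rw [← hae, hxL _ haJ]))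
  rw [← hex, ← hb, mul_assoc, hae]
  exact mul_mem_left_submodule q b hzq

theorem IsPrimitiveIdempotent.isGradedSimple_rightIdeal (hA : IsGradedArtinian R 𝒜) {e : R}
    (he : IsPrimitiveIdempotent 𝒜 e) {x : R} {g : G} (hx : x ∈ 𝒜 g) (hx0 : x ≠ 0)
    (hxe : x * e = x) (hxT : x ∈ rightSocle 𝒜) : IsGradedSimple 𝒜 (rightIdeal x) := by
  refine ⟨isHomogeneous_rightIdeal hx, fun h => hx0 (by simpa [rightIdeal] using h),
    fun q hq hqx => or_iff_not_imp_left.2 fun hq0 => le_antisymm hqx (rightIdeal_le.2 ?_)⟩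
  obtain ⟨h, z, hz, hzq, hz0⟩ := exists_homogeneous_ne_zero hq hq0
  obtain ⟨a, ha, rfl⟩ := exists_homogeneous_right_factor hx hz (hqx hzq)
  have hae : x * (e * a) = x * a := by rw [← mul_assoc, hxe]
  obtain ⟨b, -, hb⟩ := he.exists_right_inv hA (mul_mem_of_add_eq he.mem_zero ha (zero_add _))
    (by rw [← mul_assoc, he.idem.eq]) (fun haJ => hz0 (by rw [← hae, hxT _ haJ]))
  rw [← hxe, ← hb, ← mul_assoc, hae]
  exact mul_mem_right_submodule q hzq b

variable {t : ℕ} {e : Fin t → R}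

/-- The radical kills graded simple left ideals. Conversely, a homogeneous element it kills is
recovered from its parts `e i * (b * x)`, each zero or a generator of a graded simple left ideal. -/
theorem IsRepresentativeSystem.gradedSocle_eq (hA : IsGradedArtinian R 𝒜)
    (he : IsRepresentativeSystem 𝒜 e) {p : Submodule R R} (hp : p.IsHomogeneous 𝒜) :
    gradedSocle 𝒜 p = p ⊓ leftSocle 𝒜 := by
  refine le_antisymm (sSup_le fun q hq => le_inf hq.1 hq.2.le_leftSocle) ?_
  refine le_of_homogeneous_mem (isHomogeneous_inf hp isHomogeneous_leftSocle) fun g x hx hxp => ?_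
  refine he.mem_of_left hA _ fun i k b hb => ?_
  by_cases h0 : e i * (b * x) = 0
  · rw [h0]
    exact zero_mem _
  have hmem : e i * (b * x) ∈ p ⊓ leftSocle 𝒜 :=
    mul_mem_left_submodule _ _ (mul_mem_left_submodule _ _ hxp)
  have hs := (he.isPrimitiveIdempotent i).isGradedSimple_leftIdeal hA
    (SetLike.mul_mem_graded (he.mem_zero i) (SetLike.mul_mem_graded hb hx)) h0
    (by rw [← mul_assoc, (he.idempotent i).eq]) hmem.2
  exact (le_sSup ⟨leftIdeal_le.2 hmem.1, hs⟩ : _ ≤ gradedSocle 𝒜 p) (self_mem_leftIdeal _)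

theorem IsRepresentativeSystem.gradedSocle_eq_right (hA : IsGradedArtinian R 𝒜)
    (he : IsRepresentativeSystem 𝒜 e) {p : Submodule Rᵐᵒᵖ R} (hp : p.IsHomogeneous 𝒜) :
    gradedSocle 𝒜 p = p ⊓ rightSocle 𝒜 := by
  refine le_antisymm (sSup_le fun q hq => le_inf hq.1 hq.2.le_rightSocle) ?_
  refine le_of_homogeneous_mem (isHomogeneous_inf hp isHomogeneous_rightSocle) fun g x hx hxp => ?_
  refine he.mem_of_right hA _ fun i k b hb => ?_
  by_cases h0 : x * b * e i = 0
  · rw [h0]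
    exact zero_mem _
  have hmem : x * b * e i ∈ p ⊓ rightSocle 𝒜 :=
    mul_mem_right_submodule _ (mul_mem_right_submodule _ hxp _) _
  have hs := (he.isPrimitiveIdempotent i).isGradedSimple_rightIdeal hA
    (SetLike.mul_mem_graded (SetLike.mul_mem_graded hx hb) (he.mem_zero i)) h0
    (by rw [mul_assoc, (he.idempotent i).eq]) hmem.2
  exact (le_sSup ⟨rightIdeal_le.2 hmem.1, hs⟩ : _ ≤ gradedSocle 𝒜 p) (self_mem_rightIdeal _)

end Socle

/-- In an antitone Galois connection between well-founded orders that carries covering pairs to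
pairs with nothing strictly between, every element above a closed bottom is closed. -/
theorem closed_of_covBy {P Q : Type*} [PartialOrder P] [PartialOrder Q] [OrderBot P]
    [WellFoundedLT P] [WellFoundedLT Q] (r : P → Q) (l : Q → P)
    (gc : ∀ U A, A ≤ r U ↔ U ≤ l A)
    (hr : ∀ U V, U ⋖ V → ∀ C, r V ≤ C → C ≤ r U → C = r V ∨ C = r U)
    (hl : ∀ A B, A ⋖ B → ∀ C, l B ≤ C → C ≤ l A → C = l B ∨ C = l A)
    (hbot : l (r ⊥) = ⊥) (U : P) : l (r U) = U := by
  have le_lr : ∀ U, U ≤ l (r U) := fun U => (gc U _).1 le_rfl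
  have r_anti : ∀ U V, U ≤ V → r V ≤ r U := fun U V h => (gc _ _).2 (h.trans (le_lr V))
  have l_anti : ∀ A B, A ≤ B → l B ≤ l A := fun A B h => (gc _ _).1 (h.trans ((gc _ _).2 le_rfl))
  -- Since `r U` covers `r V`, nothing lies strictly between `l (r U) = U` and `l (r V)`; but `V`
  -- lies there and differs from `U`.
  have step : ∀ U V, l (r U) = U → U ⋖ V → l (r V) = V := by
    intro U V hU hUV
    have hne : r V ≠ r U := fun h => hUV.lt.not_ge (by rw [← hU, ← h]; exact le_lr V)
    have hcov : r V ⋖ r U := ⟨lt_of_le_of_ne (r_anti _ _ hUV.le) hne, fun C h1 h2 => by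
      rcases hr U V hUV C h1.le h2.le with h | h
      · exact h1.ne' h
      · exact h2.ne h⟩
    rcases hl _ _ hcov V (hU.le.trans hUV.le) (le_lr V) with h | h
    · exact absurd (h.trans hU) hUV.lt.ne'
    · exact h.symm
  -- Minimality of `r V` in `Q` replaces an ascending chain condition on the closed elements below
  -- `U`.
  obtain ⟨_, ⟨V, ⟨hV, hVU⟩, rfl⟩, hmin⟩ := (wellFounded_lt (α := Q)).has_min
    (r '' {V | l (r V) = V ∧ V ≤ U}) ⟨_, ⊥, ⟨hbot, bot_le⟩, rfl⟩
  rcases hVU.eq_or_lt with rfl | hlt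
  · exact hV
  obtain ⟨W, hVW, hWU⟩ := exists_covBy_le_of_lt hlt
  have hW := step V W hV hVW
  have heq : r W = r V := eq_of_le_of_not_lt (r_anti _ _ hVW.le) (hmin _ ⟨W, ⟨hW, hWU⟩, rfl⟩)
  exact absurd (by rw [← hV, ← hW, heq]) hVW.lt.ne

/-! ### Annihilators of covers, and the sufficient condition. -/

section Annihilators

variable {G R : Type*} [Ring R] [AddGroup G] [DecidableEq G] {𝒜 : G → AddSubgroup R}
  [GradedRing 𝒜] {t : ℕ} {e : Fin t → R}

theorem le_rightAnn_iff {U : Submodule R R} {A : Submodule Rᵐᵒᵖ R} :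
    A ≤ rightAnn (U : Set R) ↔ U ≤ leftAnn (A : Set R) :=
  ⟨fun h _ hx _ ha => h ha _ hx, fun h _ ha _ hx => h hx _ ha⟩

/-- `V / U` is generated by some `x = e i * x`. The map `y ↦ x * y` sends the annihilator of `U`
into the `e i`-part of the left socle, with kernel the annihilator of `V`, and `hsimple` makes that
target zero or graded simple. -/
theorem IsRepresentativeSystem.rightAnn_between (hA : IsGradedArtinian R 𝒜)
    (he : IsRepresentativeSystem 𝒜 e)
    (hsimple : ∀ i g h, ∀ z ∈ 𝒜 g, ∀ w ∈ 𝒜 h, z ∈ leftSocle 𝒜 → w ∈ leftSocle 𝒜 →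
      e i * z = z → e i * w = w → z ≠ 0 → w ∈ rightIdeal z)
    {U V : Submodule R R} (hU : U.IsHomogeneous 𝒜) (hV : V.IsHomogeneous 𝒜) (hUV : U < V)
    (h : ∀ C : Submodule R R, C.IsHomogeneous 𝒜 → U ≤ C → C ≤ V → C = U ∨ C = V)
    {C : Submodule Rᵐᵒᵖ R} (hC : C.IsHomogeneous 𝒜) (hVC : rightAnn (V : Set R) ≤ C)
    (hCU : C ≤ rightAnn (U : Set R)) :
    C = rightAnn (V : Set R) ∨ C = rightAnn (U : Set R) := by
  obtain ⟨i, g, x, hx, hxV, hxU, hex⟩ : ∃ i g, ∃ x ∈ 𝒜 g, x ∈ V ∧ x ∉ U ∧ e i * x = x := by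
    obtain ⟨g, y, hy, hyV, hyU⟩ := exists_homogeneous_mem_notMem hV hUV.not_ge
    by_contra! hc
    refine hyU (he.mem_of_left hA U fun i k b hb => ?_)
    by_contra hn
    exact hc i _ _ (SetLike.mul_mem_graded (he.mem_zero i) (SetLike.mul_mem_graded hb hy))
      (mul_mem_left_submodule V _ (mul_mem_left_submodule V _ hyV)) hn
      (by rw [← mul_assoc, (he.idempotent i).eq])
  have hspan : U ⊔ leftIdeal x = V :=
    (h _ (isHomogeneous_sup hU (isHomogeneous_leftIdeal hx)) le_sup_left
      (sup_le hUV.le (leftIdeal_le.2 hxV))).resolve_left fun h0 =>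
        hxU (h0 ▸ (le_sup_right : _ ≤ U ⊔ leftIdeal x) (self_mem_leftIdeal x))
  have hann : ∀ y ∈ rightAnn (U : Set R), x * y = 0 → y ∈ rightAnn (V : Set R) := by
    intro y hy hxy v hv
    obtain ⟨u, hu, z, hz, rfl⟩ := Submodule.mem_sup.1 (hspan ▸ hv : v ∈ U ⊔ leftIdeal x)
    obtain ⟨r, rfl⟩ := mem_leftIdeal.1 hz
    rw [add_mul, hy u hu, mul_assoc, hxy, mul_zero, add_zero]
  have hsoc : ∀ y ∈ rightAnn (U : Set R), x * y ∈ leftSocle 𝒜 := fun y hy c hc => by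
    rw [← mul_assoc]
    exact hy _ (gradedJacobson_mul_mem hU hV hUV.le h hc hxV)
  refine or_iff_not_imp_left.2 fun hne => le_antisymm hCU ?_
  obtain ⟨k, c, hc, hcC, hcV⟩ := exists_homogeneous_mem_notMem hC
    (fun hle => hne (le_antisymm hle hVC))
  have hxc : x * c ≠ 0 := fun h0 => hcV (hann c (hCU hcC) h0)
  refine le_of_homogeneous_mem (isHomogeneous_rightAnn hU) fun l a ha haU => ?_
  obtain ⟨r, hr⟩ := mem_rightIdeal.1 (hsimple i _ _ _ (SetLike.mul_mem_graded hx hc) _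
    (SetLike.mul_mem_graded hx ha) (hsoc c (hCU hcC)) (hsoc a haU)
    (by rw [← mul_assoc, hex]) (by rw [← mul_assoc, hex]) hxc)
  have hcr : c * r ∈ C := mul_mem_right_submodule C hcC r
  have := hVC (hann (a - c * r) (Submodule.sub_mem _ haU (hCU hcr))
    (by rw [mul_sub, ← hr, mul_assoc, sub_self]))
  simpa using C.add_mem this hcr

theorem IsRepresentativeSystem.leftAnn_between (hA : IsGradedArtinian R 𝒜)
    (he : IsRepresentativeSystem 𝒜 e)
    (hsimple : ∀ i g h, ∀ z ∈ 𝒜 g, ∀ w ∈ 𝒜 h, z ∈ rightSocle 𝒜 → w ∈ rightSocle 𝒜 →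
      z * e i = z → w * e i = w → z ≠ 0 → w ∈ leftIdeal z)
    {U V : Submodule Rᵐᵒᵖ R} (hU : U.IsHomogeneous 𝒜) (hV : V.IsHomogeneous 𝒜) (hUV : U < V)
    (h : ∀ C : Submodule Rᵐᵒᵖ R, C.IsHomogeneous 𝒜 → U ≤ C → C ≤ V → C = U ∨ C = V)
    {C : Submodule R R} (hC : C.IsHomogeneous 𝒜) (hVC : leftAnn (V : Set R) ≤ C)
    (hCU : C ≤ leftAnn (U : Set R)) :
    C = leftAnn (V : Set R) ∨ C = leftAnn (U : Set R) := by
  obtain ⟨i, g, x, hx, hxV, hxU, hex⟩ : ∃ i g, ∃ x ∈ 𝒜 g, x ∈ V ∧ x ∉ U ∧ x * e i = x := by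
    obtain ⟨g, y, hy, hyV, hyU⟩ := exists_homogeneous_mem_notMem hV hUV.not_ge
    by_contra! hc
    refine hyU (he.mem_of_right hA U fun i k b hb => ?_)
    by_contra hn
    exact hc i _ _ (SetLike.mul_mem_graded (SetLike.mul_mem_graded hy hb) (he.mem_zero i))
      (mul_mem_right_submodule V (mul_mem_right_submodule V hyV _) _) hn
      (by rw [mul_assoc, (he.idempotent i).eq])
  have hspan : U ⊔ rightIdeal x = V :=
    (h _ (isHomogeneous_sup hU (isHomogeneous_rightIdeal hx)) le_sup_left
      (sup_le hUV.le (rightIdeal_le.2 hxV))).resolve_left fun h0 =>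
        hxU (h0 ▸ (le_sup_right : _ ≤ U ⊔ rightIdeal x) (self_mem_rightIdeal x))
  have hann : ∀ y ∈ leftAnn (U : Set R), y * x = 0 → y ∈ leftAnn (V : Set R) := by
    intro y hy hxy v hv
    obtain ⟨u, hu, z, hz, rfl⟩ := Submodule.mem_sup.1 (hspan ▸ hv : v ∈ U ⊔ rightIdeal x)
    obtain ⟨r, rfl⟩ := mem_rightIdeal.1 hz
    rw [mul_add, hy u hu, ← mul_assoc, hxy, zero_mul, add_zero]
  have hsoc : ∀ y ∈ leftAnn (U : Set R), y * x ∈ rightSocle 𝒜 := fun y hy c hc => by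
    rw [mul_assoc]
    exact hy _ (mul_gradedJacobson_mem hU hV hUV.le h hc hxV)
  refine or_iff_not_imp_left.2 fun hne => le_antisymm hCU ?_
  obtain ⟨k, c, hc, hcC, hcV⟩ := exists_homogeneous_mem_notMem hC
    (fun hle => hne (le_antisymm hle hVC))
  have hxc : c * x ≠ 0 := fun h0 => hcV (hann c (hCU hcC) h0)
  refine le_of_homogeneous_mem (isHomogeneous_leftAnn hU) fun l a ha haU => ?_
  obtain ⟨r, hr⟩ := mem_leftIdeal.1 (hsimple i _ _ _ (SetLike.mul_mem_graded hc hx) _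
    (SetLike.mul_mem_graded ha hx) (hsoc c (hCU hcC)) (hsoc a haU)
    (by rw [mul_assoc, hex]) (by rw [mul_assoc, hex]) hxc)
  have hcr : r * c ∈ C := mul_mem_left_submodule C r hcC
  have := hVC (hann (a - r * c) (Submodule.sub_mem _ haU (hCU hcr))
    (by rw [sub_mul, ← hr, mul_assoc, sub_self]))
  simpa using C.add_mem this hcr

/-- The double annihilator conditions hold if the two socles coincide and the modules
`e_i soc(R)` and `soc(R) e_i` are zero or graded simple. -/
theorem IsRepresentativeSystem.isGradedQuasiFrobenius (hR : IsGradedArtinianRing 𝒜)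
    (he : IsRepresentativeSystem 𝒜 e)
    (hsoc : ∀ x, x ∈ leftSocle 𝒜 ↔ x ∈ rightSocle 𝒜)
    (hright : ∀ i g h, ∀ z ∈ 𝒜 g, ∀ w ∈ 𝒜 h, z ∈ rightSocle 𝒜 → w ∈ rightSocle 𝒜 →
      e i * z = z → e i * w = w → z ≠ 0 → w ∈ rightIdeal z)
    (hleft : ∀ i g h, ∀ z ∈ 𝒜 g, ∀ w ∈ 𝒜 h, z ∈ leftSocle 𝒜 → w ∈ leftSocle 𝒜 →
      z * e i = z → w * e i = w → z ≠ 0 → w ∈ leftIdeal z) :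
    IsGradedQuasiFrobenius 𝒜 := by
  -- Equality of the socles turns the hypotheses into those of the annihilator lemmas, which involve
  -- the socle of the other side.
  simp only [← hsoc] at hright
  simp only [hsoc] at hleft
  let P := {p : Submodule R R // p.IsHomogeneous 𝒜}
  let Q := {p : Submodule Rᵐᵒᵖ R // p.IsHomogeneous 𝒜}
  let _ : OrderBot P := 
    { bot := ⟨⊥, isHomogeneous_bot⟩, bot_le := fun p => (bot_le : ⊥ ≤ p.1) }
  let _ : OrderBot Q := 
    { bot := ⟨⊥, isHomogeneous_bot⟩, bot_le := fun p => (bot_le : ⊥ ≤ p.1) }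
  have : WellFoundedLT P := hR.1
  have : WellFoundedLT Q := hR.2
  let r : P → Q := fun U => ⟨rightAnn (U.1 : Set R), isHomogeneous_rightAnn U.2⟩
  let l : Q → P := fun A => ⟨leftAnn (A.1 : Set R), isHomogeneous_leftAnn A.2⟩
  have hr : ∀ U V, U ⋖ V → ∀ C, r V ≤ C → C ≤ r U → C = r V ∨ C = r U :=
    fun U V hUV C h1 h2 => (he.rightAnn_between hR.1 hright U.2 V.2 hUV.lt
      (forall_between_of_covBy hUV) C.2 h1 h2).imp Subtype.ext Subtype.ext
  have hl : ∀ A B, A ⋖ B → ∀ C, l B ≤ C → C ≤ l A → C = l B ∨ C = l A :=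
    fun U V hUV C h1 h2 => (he.leftAnn_between hR.1 hleft U.2 V.2 hUV.lt
      (forall_between_of_covBy hUV) C.2 h1 h2).imp Subtype.ext Subtype.ext
  refine ⟨hR, fun A hA => ?_, fun U hU => ?_⟩
  · refine congrArg Subtype.val (closed_of_covBy l r (fun A U => le_rightAnn_iff.symm) hl hr
      (Subtype.ext (eq_bot_iff.2 fun x hx => ?_ : _ = (⊥ : Submodule Rᵐᵒᵖ R))) ⟨A, hA⟩)
    have h1 : (1 : R) * x = 0 := hx 1 fun a ha => by
      rw [show a = 0 from ha, mul_zero]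
    rw [one_mul] at h1
    exact h1
  · refine congrArg Subtype.val (closed_of_covBy r l (fun U A => le_rightAnn_iff) hr hl
      (Subtype.ext (eq_bot_iff.2 fun x hx => ?_ : _ = (⊥ : Submodule R R))) ⟨U, hU⟩)
    have h1 : x * (1 : R) = 0 := hx 1 fun a ha => by
      rw [show a = 0 from ha, zero_mul]
    rw [mul_one] at h1
    exact h1

/-- The sufficient condition in terms of homogeneous generators of the socles of the modules
`Re_i` and `e_{π(i)}R`. -/
theorem IsRepresentativeSystem.isGradedQuasiFrobenius_of_generators (hR : IsGradedArtinianRing 𝒜)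
    (he : IsRepresentativeSystem 𝒜 e) (π : Equiv.Perm (Fin t))
    (hl : ∀ i, ∃ g, ∃ x ∈ 𝒜 g, x ≠ 0 ∧ e (π i) * x = x ∧
      gradedSocle 𝒜 (leftIdeal (e i)) = leftIdeal x)
    (hr : ∀ i, ∃ g, ∃ y ∈ 𝒜 g, y ≠ 0 ∧ y * e i = y ∧
      gradedSocle 𝒜 (rightIdeal (e (π i))) = rightIdeal y) :
    IsGradedQuasiFrobenius 𝒜 := by
  have hsl : ∀ i, gradedSocle 𝒜 (leftIdeal (e i)) = leftIdeal (e i) ⊓ leftSocle 𝒜 := fun i =>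
    he.gradedSocle_eq hR.1 (isHomogeneous_leftIdeal (he.mem_zero i))
  have hsr : ∀ i, gradedSocle 𝒜 (rightIdeal (e i)) = rightIdeal (e i) ⊓ rightSocle 𝒜 := fun i =>
    he.gradedSocle_eq_right hR.1 (isHomogeneous_rightIdeal (he.mem_zero i))
  have hsimpl : ∀ i, IsGradedSimple 𝒜 (leftIdeal (e i) ⊓ leftSocle 𝒜) := fun i => by
    obtain ⟨g, x, hx, hx0, hex, hs⟩ := hl i
    rw [← hsl, hs]
    refine (he.isPrimitiveIdempotent (π i)).isGradedSimple_leftIdeal hR.1 hx hx0 hex ?_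
    have := self_mem_leftIdeal x
    rw [← hs, hsl] at this
    exact this.2
  have hsimpr : ∀ i, IsGradedSimple 𝒜 (rightIdeal (e (π i)) ⊓ rightSocle 𝒜) := fun i => by
    obtain ⟨g, x, hx, hx0, hex, hs⟩ := hr i
    rw [← hsr, hs]
    refine (he.isPrimitiveIdempotent i).isGradedSimple_rightIdeal hR.1 hx hx0 hex ?_
    have := self_mem_rightIdeal x
    rw [← hs, hsr] at this
    exact this.2
  -- The generator `y` of a right socle also generates a nonzero left ideal inside `Re_i`, which
  -- must contain the simple socle of `Re_i`; all of `Ry` lies in `rightSocle 𝒜`.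
  have hLT : ∀ x ∈ leftSocle 𝒜, x ∈ rightSocle 𝒜 := by
    intro x hx
    refine he.mem_of_right hR.1 _ fun i g b hb => ?_
    obtain ⟨k, y, hy, hy0, hye, hs⟩ := hr i
    have hyT : y ∈ rightSocle 𝒜 := by
      have := self_mem_rightIdeal y
      rw [← hs, hsr] at this
      exact this.2
    obtain ⟨q, hqy, hq⟩ := exists_isGradedSimple_le hR.1 (isHomogeneous_leftIdeal hy)
      (fun h => hy0 (by simpa [leftIdeal] using h))
    have hq' : q ≤ leftIdeal (e i) ⊓ leftSocle 𝒜 := le_inf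
      (hqy.trans (leftIdeal_le.2 ((mem_leftIdeal_iff_mul_eq (he.idempotent i)).2 hye)))
      hq.le_leftSocle
    have heq := ((hsimpl i).eq_bot_or_eq q hq.homogeneous hq').resolve_left hq.ne_bot
    have hmem : x * b * e i ∈ q := by
      rw [heq]
      exact ⟨mul_mem_leftIdeal _ _, mul_right_mem_leftSocle (mul_right_mem_leftSocle hx b) _⟩
    obtain ⟨a, ha⟩ := mem_leftIdeal.1 (hqy hmem)
    rw [← ha]
    exact mul_left_mem_rightSocle hyT a
  have hTL : ∀ x ∈ rightSocle 𝒜, x ∈ leftSocle 𝒜 := by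
    intro x hx
    refine he.mem_of_left hR.1 _ fun j g b hb => ?_
    -- The hypotheses describe right socles only at indices of the form `π i`.
    obtain ⟨i, rfl⟩ := π.surjective j
    obtain ⟨k, y, hy, hy0, hye, hs⟩ := hl i
    have hyT : y ∈ leftSocle 𝒜 := by
      have := self_mem_leftIdeal y
      rw [← hs, hsl] at this
      exact this.2
    obtain ⟨q, hqy, hq⟩ := exists_isGradedSimple_le hR.2 (isHomogeneous_rightIdeal hy)
      (fun h => hy0 (by simpa [rightIdeal] using h))
    have hq' : q ≤ rightIdeal (e (π i)) ⊓ rightSocle 𝒜 := le_inf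
      (hqy.trans (rightIdeal_le.2 ((mem_rightIdeal_iff_mul_eq (he.idempotent _)).2 hye)))
      hq.le_rightSocle
    have heq := ((hsimpr i).eq_bot_or_eq q hq.homogeneous hq').resolve_left hq.ne_bot
    have hmem : e (π i) * (b * x) ∈ q := by
      rw [heq]
      exact ⟨mul_mem_rightIdeal _ _, mul_left_mem_rightSocle (mul_left_mem_rightSocle hx b) _⟩
    obtain ⟨a, ha⟩ := mem_rightIdeal.1 (hqy hmem)
    rw [← ha]
    exact mul_right_mem_leftSocle hyT a
  refine he.isGradedQuasiFrobenius hR (fun x => ⟨hLT x, hTL x⟩) ?_ ?_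
  · intro j g h z hz w hw hzT hwT hez hew hz0
    obtain ⟨i, rfl⟩ := π.surjective j
    have hm : ∀ u, e (π i) * u = u → u ∈ rightSocle 𝒜 →
        u ∈ rightIdeal (e (π i)) ⊓ rightSocle 𝒜 := fun u h1 h2 =>
      ⟨(mem_rightIdeal_iff_mul_eq (he.idempotent _)).2 h1, h2⟩
    rw [(hsimpr i).eq_of_mem (isHomogeneous_rightIdeal hz) (rightIdeal_le.2 (hm z hez hzT))
      (self_mem_rightIdeal z) hz0]
    exact hm w hew hwT
  · intro i g h z hz w hw hzT hwT hez hew hz0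
    have hm : ∀ u, u * e i = u → u ∈ leftSocle 𝒜 →
        u ∈ leftIdeal (e i) ⊓ leftSocle 𝒜 := fun u h1 h2 =>
      ⟨(mem_leftIdeal_iff_mul_eq (he.idempotent _)).2 h1, h2⟩
    rw [(hsimpl i).eq_of_mem (isHomogeneous_leftIdeal hz) (leftIdeal_le.2 (hm z hez hzT))
      (self_mem_leftIdeal z) hz0]
    exact hm w hew hwT

end Annihilators

/-! ### Socles as shifted tops, and isoshift types. -/

section Isomorphisms

/-- This is the first isomorphism theorem with degrees: `s` records the shift, and `hlift` supplies
homogeneous preimages. -/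
theorem gradedIso_quotGrading {G S M N : Type*} [Ring S] [AddCommGroup M] [Module S M]
    [AddCommGroup N] [Module S N] (ℳ : G → AddSubgroup M) (𝒩 : G → AddSubgroup N)
    (K : Submodule S M) (φ : M →ₗ[S] N) (hφ : Function.Surjective φ) (hK : LinearMap.ker φ = K)
    (s : G → G) (hmap : ∀ g, ∀ z ∈ ℳ (s g), φ z ∈ 𝒩 g)
    (hlift : ∀ g, ∀ y ∈ 𝒩 g, ∃ z ∈ ℳ (s g), φ z = y) :
    GradedIso S 𝒩 fun g => quotGrading ℳ K (s g) := by
  subst hK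
  refine ⟨(φ.quotKerEquivOfSurjective hφ).symm, fun g y => ⟨fun hy => ?_, ?_⟩⟩
  · obtain ⟨z, hz, rfl⟩ := hlift g y hy
    refine ⟨z, hz, ?_⟩
    rw [LinearEquiv.eq_symm_apply]
    rfl
  · rintro ⟨z, hz, h⟩
    rw [LinearEquiv.eq_symm_apply] at h
    rw [← h]
    exact hmap g z hz

variable {G R : Type*} [Ring R] [AddGroup G] [DecidableEq G] {𝒜 : G → AddSubgroup R}
  [GradedRing 𝒜]

theorem mem_jacobsonMul {e y : R} (he : IsIdempotentElem e) :
    y ∈ jacobsonMul 𝒜 e ↔ y ∈ gradedJacobson 𝒜 ∧ y * e = y := by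
  refine ⟨fun hy => ?_, fun h => Submodule.subset_span ⟨y, h⟩⟩
  have : jacobsonMul 𝒜 e ≤ gradedJacobson 𝒜 ⊓ leftIdeal e := by
    refine Submodule.span_le.2 ?_
    rintro _ ⟨x, hx, rfl⟩
    exact ⟨mul_mem_gradedJacobson hx e, mul_mem_leftIdeal x e⟩
  exact ⟨(this hy).1, (mem_leftIdeal_iff_mul_eq he).1 (this hy).2⟩

theorem mem_mulJacobson {e y : R} (he : IsIdempotentElem e) :
    y ∈ mulJacobson 𝒜 e ↔ y ∈ gradedJacobson 𝒜 ∧ e * y = y := by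
  refine ⟨fun hy => ?_, fun h => Submodule.subset_span ⟨y, h⟩⟩
  refine ⟨?_, ?_⟩
  · induction hy using Submodule.span_induction with
    | mem _ h =>
      obtain ⟨x, hx, rfl⟩ := h
      exact mul_mem_left_submodule _ e hx
    | zero => exact zero_mem _
    | add _ _ _ _ h1 h2 => exact add_mem h1 h2
    | smul a _ _ h => exact mul_mem_gradedJacobson h a.unop
  · have : mulJacobson 𝒜 e ≤ rightIdeal e := by
      refine Submodule.span_le.2 ?_
      rintro _ ⟨x, -, rfl⟩
      exact mul_mem_rightIdeal e x
    exact (mem_rightIdeal_iff_mul_eq he).1 (this hy)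

/-- A component of `z` outside the radical could be multiplied back to `e`, so it cannot kill `x = e
* x`. This identifies the kernel of `Re → Rx` as `Je`. -/
theorem IsPrimitiveIdempotent.mul_eq_zero_iff (hA : IsGradedArtinian R 𝒜) {e : R}
    (he : IsPrimitiveIdempotent 𝒜 e) {x : R} {d : G} (hx : x ∈ 𝒜 d) (hx0 : x ≠ 0)
    (hex : e * x = x) (hxL : x ∈ leftSocle 𝒜) {z : R} (hz : z * e = z) :
    z * x = 0 ↔ z ∈ gradedJacobson 𝒜 := by
  refine ⟨fun h => mem_of_components_mem (ℳ := 𝒜) (gradedJacobson 𝒜).toAddSubgroup fun g => ?_,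
    fun h => hxL z h⟩
  by_contra hJ
  have hzg : (decompose 𝒜 z g : R) * e = decompose 𝒜 z g := by
    conv_rhs => rw [← hz, decompose_mul_of_right_mem he.mem_zero, sub_zero]
  have hzx : (decompose 𝒜 z g : R) * x = 0 := by
    have := decompose_mul_of_right_mem (a := z) hx (g + d)
    rw [h, add_sub_cancel_right] at this
    rw [← this]
    simp
  obtain ⟨b, -, hb⟩ := he.exists_left_inv hA (SetLike.coe_mem _) hzg hJ
  exact hx0 (by rw [← hex, ← hb, mul_assoc, hzx, mul_zero])

theorem IsPrimitiveIdempotent.mul_eq_zero_iff_right (hA : IsGradedArtinian R 𝒜) {e : R}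
    (he : IsPrimitiveIdempotent 𝒜 e) {x : R} {d : G} (hx : x ∈ 𝒜 d) (hx0 : x ≠ 0)
    (hxe : x * e = x) (hxT : x ∈ rightSocle 𝒜) {z : R} (hz : e * z = z) :
    x * z = 0 ↔ z ∈ gradedJacobson 𝒜 := by
  refine ⟨fun h => mem_of_components_mem (ℳ := 𝒜) (gradedJacobson 𝒜).toAddSubgroup fun g => ?_,
    fun h => hxT z h⟩
  by_contra hJ
  have hzg : e * (decompose 𝒜 z g : R) = decompose 𝒜 z g := by
    conv_rhs => rw [← hz, decompose_mul_of_left_mem he.mem_zero, neg_zero, zero_add]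
  have hzx : x * (decompose 𝒜 z g : R) = 0 := by
    have := decompose_mul_of_left_mem (b := z) hx (d + g)
    rw [h, neg_add_cancel_left] at this
    rw [← this]
    simp
  obtain ⟨b, -, hb⟩ := he.exists_right_inv hA (SetLike.coe_mem _) hzg hJ
  exact hx0 (by rw [← hxe, ← hb, ← mul_assoc, hzx, zero_mul])

/-- Right multiplication by `x` maps `Re` onto `Rx` and raises degrees by `d`, whence the shift by
`-d`. -/
theorem IsPrimitiveIdempotent.gradedIso_leftTop (hA : IsGradedArtinian R 𝒜) {e : R}
    (he : IsPrimitiveIdempotent 𝒜 e) {x : R} {d : G} (hx : x ∈ 𝒜 d) (hx0 : x ≠ 0)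
    (hex : e * x = x) (hxL : x ∈ leftSocle 𝒜) :
    GradedIso R (subGrading 𝒜 (leftIdeal x)) (leftShift (leftTopGrading 𝒜 e) (-d)) := by
  have hres : ∀ z ∈ leftIdeal e, LinearMap.mulRight R x z ∈ leftIdeal x := fun z _ =>
    mul_mem_leftIdeal z x
  refine gradedIso_quotGrading (subGrading 𝒜 (leftIdeal e)) (subGrading 𝒜 (leftIdeal x)) _
    ((LinearMap.mulRight R x).restrict hres) ?_ ?_ (fun g => g + -d) ?_ ?_
  · rintro ⟨y, hy⟩
    obtain ⟨a, rfl⟩ := mem_leftIdeal.1 hy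
    exact ⟨⟨a * e, mul_mem_leftIdeal a e⟩, Subtype.ext (show a * e * x = a * x by
      rw [mul_assoc, hex])⟩
  · ext ⟨z, hz⟩
    have hze := (mem_leftIdeal_iff_mul_eq he.idem).1 hz
    rw [LinearMap.mem_ker, Submodule.submoduleOf, Submodule.mem_comap,
      Submodule.subtype_apply, mem_jacobsonMul he.idem, Subtype.ext_iff]
    exact (he.mul_eq_zero_iff hA hx hx0 hex hxL hze).trans (by simp [hze])
  · rintro g ⟨z, hz⟩ hzg
    exact mul_mem_of_add_eq (show z ∈ 𝒜 (g + -d) from hzg) hx (by simp)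
  · rintro g ⟨y, hy⟩ hyg
    obtain ⟨a, ha, rfl⟩ := exists_homogeneous_left_factor hx (show y ∈ 𝒜 g from hyg) hy
    exact ⟨⟨a * e, mul_mem_leftIdeal a e⟩,
      show a * e ∈ 𝒜 (g + -d) from mul_mem_of_add_eq ha he.mem_zero (by simp [sub_eq_add_neg]),
      Subtype.ext (show a * e * x = a * x by rw [mul_assoc, hex])⟩

theorem IsPrimitiveIdempotent.gradedIso_rightTop (hA : IsGradedArtinian R 𝒜) {e : R}
    (he : IsPrimitiveIdempotent 𝒜 e) {x : R} {d : G} (hx : x ∈ 𝒜 d) (hx0 : x ≠ 0)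
    (hxe : x * e = x) (hxT : x ∈ rightSocle 𝒜) :
    GradedIso Rᵐᵒᵖ (subGrading 𝒜 (rightIdeal x)) (rightShift (-d) (rightTopGrading 𝒜 e)) := by
  have hres : ∀ z ∈ rightIdeal e, LinearMap.mulLeft Rᵐᵒᵖ x z ∈ rightIdeal x := fun z _ =>
    mul_mem_rightIdeal x z
  refine gradedIso_quotGrading (subGrading 𝒜 (rightIdeal e)) (subGrading 𝒜 (rightIdeal x)) _
    ((LinearMap.mulLeft Rᵐᵒᵖ x).restrict hres) ?_ ?_ (fun g => -d + g) ?_ ?_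
  · rintro ⟨y, hy⟩
    obtain ⟨a, rfl⟩ := mem_rightIdeal.1 hy
    exact ⟨⟨e * a, mul_mem_rightIdeal e a⟩, Subtype.ext (show x * (e * a) = x * a by
      rw [← mul_assoc, hxe])⟩
  · ext ⟨z, hz⟩
    have hze := (mem_rightIdeal_iff_mul_eq he.idem).1 hz
    rw [LinearMap.mem_ker, Submodule.submoduleOf, Submodule.mem_comap,
      Submodule.subtype_apply, mem_mulJacobson he.idem, Subtype.ext_iff]
    exact (he.mul_eq_zero_iff_right hA hx hx0 hxe hxT hze).trans (by simp [hze])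
  · rintro g ⟨z, hz⟩ hzg
    exact mul_mem_of_add_eq hx (show z ∈ 𝒜 (-d + g) from hzg) (by simp)
  · rintro g ⟨y, hy⟩ hyg
    obtain ⟨a, ha, rfl⟩ := exists_homogeneous_right_factor hx (show y ∈ 𝒜 g from hyg) hy
    exact ⟨⟨e * a, mul_mem_rightIdeal e a⟩,
      show e * a ∈ 𝒜 (-d + g) from mul_mem_of_add_eq he.mem_zero ha (by simp),
      Subtype.ext (show x * (e * a) = x * a by rw [← mul_assoc, hxe])⟩

/-- The generator is the preimage of the class of `e`. That class is fixed by `e`, is nonzero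
because `e` is outside the radical, and has degree `-σ` after the shift. -/
theorem IsPrimitiveIdempotent.exists_generator_of_gradedIso (hA : IsGradedArtinian R 𝒜) {e : R}
    (he : IsPrimitiveIdempotent 𝒜 e) {p : Submodule R R} {σ : G}
    (h : GradedIso R (subGrading 𝒜 p) (leftShift (leftTopGrading 𝒜 e) σ)) :
    ∃ g, ∃ x ∈ 𝒜 g, x ≠ 0 ∧ e * x = x ∧ p = leftIdeal x := by
  obtain ⟨f, hf⟩ := h
  let E : leftIdeal e := ⟨e, self_mem_leftIdeal e⟩
  let E' : LeftTop 𝒜 e := Submodule.Quotient.mk E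
  have hEE : e • E' = E' := by
    rw [← Submodule.Quotient.mk_smul]
    exact congrArg _ (Subtype.ext he.idem.eq)
  refine ⟨-σ, (f.symm E' : R), ?_, fun h0 => ?_, ?_, le_antisymm (fun y hy => ?_)
    (leftIdeal_le.2 (f.symm E').2)⟩
  · refine (hf (-σ) (f.symm E')).2 ?_
    rw [f.apply_symm_apply]
    refine ⟨E, ?_, rfl⟩
    change e ∈ 𝒜 (-σ + σ)
    rw [neg_add_cancel]
    exact he.mem_zero
  · have h1 : f.symm E' = 0 := Subtype.ext h0
    rw [LinearEquiv.map_eq_zero_iff, Submodule.Quotient.mk_eq_zero, Submodule.submoduleOf, Submodule.mem_comap,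
      Submodule.subtype_apply,
      mem_jacobsonMul he.idem] at h1
    exact he.notMem_gradedJacobson hA h1.1
  · have h1 : e • f.symm E' = f.symm E' := by rw [← map_smul, hEE]
    exact congrArg Subtype.val h1
  · obtain ⟨⟨z, hz⟩, hz'⟩ := Submodule.Quotient.mk_surjective _ (f ⟨y, hy⟩)
    have h1 : f ⟨y, hy⟩ = z • E' := by
      rw [← hz', ← Submodule.Quotient.mk_smul]
      exact congrArg _ (Subtype.ext ((mem_leftIdeal_iff_mul_eq he.idem).1 hz).symm)
    have h2 : (⟨y, hy⟩ : p) = z • f.symm E' := by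
      rw [← map_smul, ← h1, f.symm_apply_apply]
    have h3 : y = z * (f.symm E' : R) := congrArg Subtype.val h2
    rw [h3]
    exact mul_mem_leftIdeal _ _

theorem IsPrimitiveIdempotent.exists_generator_of_gradedIso_right (hA : IsGradedArtinian R 𝒜)
    {e : R} (he : IsPrimitiveIdempotent 𝒜 e) {p : Submodule Rᵐᵒᵖ R} {σ : G}
    (h : GradedIso Rᵐᵒᵖ (subGrading 𝒜 p) (rightShift σ (rightTopGrading 𝒜 e))) :
    ∃ g, ∃ x ∈ 𝒜 g, x ≠ 0 ∧ x * e = x ∧ p = rightIdeal x := by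
  obtain ⟨f, hf⟩ := h
  let E : rightIdeal e := ⟨e, self_mem_rightIdeal e⟩
  let E' : RightTop 𝒜 e := Submodule.Quotient.mk E
  have hEE : MulOpposite.op e • E' = E' := by
    rw [← Submodule.Quotient.mk_smul]
    exact congrArg _ (Subtype.ext he.idem.eq)
  refine ⟨-σ, (f.symm E' : R), ?_, fun h0 => ?_, ?_, le_antisymm (fun y hy => ?_)
    (rightIdeal_le.2 (f.symm E').2)⟩
  · refine (hf (-σ) (f.symm E')).2 ?_
    rw [f.apply_symm_apply]
    refine ⟨E, ?_, rfl⟩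
    change e ∈ 𝒜 (σ + -σ)
    rw [add_neg_cancel]
    exact he.mem_zero
  · have h1 : f.symm E' = 0 := Subtype.ext h0
    rw [LinearEquiv.map_eq_zero_iff, Submodule.Quotient.mk_eq_zero, Submodule.submoduleOf, Submodule.mem_comap,
      Submodule.subtype_apply,
      mem_mulJacobson he.idem] at h1
    exact he.notMem_gradedJacobson hA h1.1
  · have h1 : MulOpposite.op e • f.symm E' = f.symm E' := by rw [← map_smul, hEE]
    exact congrArg Subtype.val h1
  · obtain ⟨⟨z, hz⟩, hz'⟩ := Submodule.Quotient.mk_surjective _ (f ⟨y, hy⟩)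
    have h1 : f ⟨y, hy⟩ = MulOpposite.op z • E' := by
      rw [← hz', ← Submodule.Quotient.mk_smul]
      exact congrArg _ (Subtype.ext ((mem_rightIdeal_iff_mul_eq he.idem).1 hz).symm)
    have h2 : (⟨y, hy⟩ : p) = MulOpposite.op z • f.symm E' := by
      rw [← map_smul, ← h1, f.symm_apply_apply]
    have h3 : y = (f.symm E' : R) * z := congrArg Subtype.val h2
    rw [h3]
    exact mul_mem_rightIdeal _ _

theorem sameIsoshiftType_of_mul_eq {e f s b : R} {g : G} (he : IsIdempotentElem e)
    (hf : IsIdempotentElem f) (hs : s ∈ 𝒜 g) (hb : b ∈ 𝒜 (-g)) (hbf : b * f = b)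
    (hse : s * e = s) (hbs : b * s = e) (hsb : s * b = f) :
    SameIsoshiftType R (subGrading 𝒜 (leftIdeal e)) (subGrading 𝒜 (leftIdeal f)) := by
  have hres : ∀ z ∈ leftIdeal e, LinearMap.mulRight R b z ∈ leftIdeal f := fun z _ =>
    (mem_leftIdeal_iff_mul_eq hf).2 (show z * b * f = z * b by rw [mul_assoc, hbf])
  have hres' : ∀ z ∈ leftIdeal f, LinearMap.mulRight R s z ∈ leftIdeal e := fun z _ =>
    (mem_leftIdeal_iff_mul_eq he).2 (show z * s * e = z * s by rw [mul_assoc, hse])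
  have h1 : ∀ z ∈ leftIdeal e, z * b * s = z := fun z hz => by
    rw [mul_assoc, hbs, (mem_leftIdeal_iff_mul_eq he).1 hz]
  have h2 : ∀ z ∈ leftIdeal f, z * s * b = z := fun z hz => by
    rw [mul_assoc, hsb, (mem_leftIdeal_iff_mul_eq hf).1 hz]
  refine ⟨-g, LinearEquiv.ofLinearMap ((LinearMap.mulRight R b).restrict hres)
    ((LinearMap.mulRight R s).restrict hres') (LinearMap.ext fun z => Subtype.ext (h2 z z.2))
    (LinearMap.ext fun z => Subtype.ext (h1 z z.2)), fun h z => ?_⟩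
  change (z : R) ∈ 𝒜 h ↔ (z : R) * b ∈ 𝒜 (h + -g)
  refine ⟨fun hz => SetLike.mul_mem_graded hz hb, fun hz => ?_⟩
  rw [← h1 z z.2]
  exact mul_mem_of_add_eq hz hs (by simp)

end Isomorphisms

/-! ### Consequences of the double annihilator conditions. -/

section QuasiFrobenius

variable {G R : Type*} [Ring R] [AddGroup G] [DecidableEq G] {𝒜 : G → AddSubgroup R}
  [GradedRing 𝒜]

/-- In a graded quasi-Frobenius ring, every nonzero graded left ideal inside `Re` contains the
`e`-part of the right socle. -/
theorem IsGradedQuasiFrobenius.mem_leftIdeal_of_mem_rightSocle (hQ : IsGradedQuasiFrobenius 𝒜)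
    {e : R} (he : IsPrimitiveIdempotent 𝒜 e) {z w : R} {g : G} (hz : z ∈ 𝒜 g) (hz0 : z ≠ 0)
    (hze : z * e = z) (hw : w ∈ rightSocle 𝒜) (hwe : w * e = w) : w ∈ leftIdeal z := by
  have hhom := isHomogeneous_leftIdeal hz
  rw [← hQ.left_double_ann _ hhom]
  refine mul_eq_zero_of_forall_homogeneous_right (isHomogeneous_rightAnn hhom) fun k y hy hyz => ?_
  have hzy : z * y = 0 := hyz z (self_mem_leftIdeal z)
  rw [← hwe, mul_assoc]
  refine hw _ ?_
  -- If `e * y` were outside the radical, `e * y * b = e` would give `z = z * y * b = 0`.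
  by_contra hJ
  obtain ⟨b, -, hb⟩ := he.exists_right_inv hQ.artinian.1
    (mul_mem_of_add_eq he.mem_zero hy (zero_add k)) (by rw [← mul_assoc, he.idem.eq]) hJ
  exact hz0 (by rw [← hze, ← hb, ← mul_assoc, ← mul_assoc, hze, hzy, zero_mul])

theorem IsGradedQuasiFrobenius.mem_rightIdeal_of_mem_leftSocle (hQ : IsGradedQuasiFrobenius 𝒜)
    {e : R} (he : IsPrimitiveIdempotent 𝒜 e) {z w : R} {g : G} (hz : z ∈ 𝒜 g) (hz0 : z ≠ 0)
    (hez : e * z = z) (hw : w ∈ leftSocle 𝒜) (hew : e * w = w) : w ∈ rightIdeal z := by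
  have hhom := isHomogeneous_rightIdeal hz
  rw [← hQ.right_double_ann _ hhom]
  refine mul_eq_zero_of_forall_homogeneous (isHomogeneous_leftAnn hhom) fun k y hy hyz => ?_
  have hyz0 : y * z = 0 := hyz z (self_mem_rightIdeal z)
  rw [← hew, ← mul_assoc]
  refine hw _ ?_
  by_contra hJ
  obtain ⟨b, -, hb⟩ := he.exists_left_inv hQ.artinian.1
    (mul_mem_of_add_eq hy he.mem_zero (add_zero k)) (by rw [mul_assoc, he.idem.eq]) hJ
  exact hz0 (by rw [← hez, ← hb, mul_assoc, mul_assoc, hez, hyz0, mul_zero])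

/-- The right ideal of all `x` with `e * x` in the radical misses `e`, so its left annihilator is
nonzero. It contains the radical and `1 - e`, so whatever annihilates it lies in the right socle and
is fixed by `e` on the right. -/
theorem IsGradedQuasiFrobenius.exists_mem_rightSocle (hQ : IsGradedQuasiFrobenius 𝒜)
    {e : R} (he : IsPrimitiveIdempotent 𝒜 e) :
    ∃ g, ∃ w ∈ 𝒜 g, w ≠ 0 ∧ w ∈ rightSocle 𝒜 ∧ w * e = w := by
  have hhom : (leftIdeal e).IsHomogeneous 𝒜 := isHomogeneous_leftIdeal he.mem_zero
  by_contra! hc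
  have h1e : 1 - e ∈ 𝒜 0 := sub_mem SetLike.GradedOne.one_mem he.mem_zero
  let A : Submodule Rᵐᵒᵖ R :=
    { carrier := {x | e * x ∈ gradedJacobson 𝒜}
      add_mem' := fun {x y} hx hy => by
        change e * (x + y) ∈ gradedJacobson 𝒜
        rw [mul_add]
        exact add_mem hx hy
      zero_mem' := by
        change e * 0 ∈ gradedJacobson 𝒜
        rw [mul_zero]
        exact zero_mem _
      smul_mem' := fun r x hx => by
        change e * (x * r.unop) ∈ gradedJacobson 𝒜
        rw [← mul_assoc]
        exact mul_mem_gradedJacobson hx _ }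
  have hA : A.IsHomogeneous 𝒜 := fun g x hx => by
    change e * (decompose 𝒜 x g : R) ∈ gradedJacobson 𝒜
    have := decompose_mul_of_left_mem (b := x) he.mem_zero g
    rw [neg_zero, zero_add] at this
    rw [← this]
    exact isHomogeneous_gradedJacobson g hx
  have hlA : leftAnn (A : Set R) = ⊥ := by
    by_contra hne
    obtain ⟨g, w, hw, hwA, hw0⟩ := exists_homogeneous_ne_zero (isHomogeneous_leftAnn hA) hne
    refine hc g w hw hw0 (fun c hcJ => hwA c (mul_mem_left_submodule _ e hcJ)) ?_
    have : w * (1 - e) = 0 := hwA _ (by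
      change e * (1 - e) ∈ gradedJacobson 𝒜
      rw [mul_sub, mul_one, he.idem.eq, sub_self]
      exact zero_mem _)
    rw [mul_sub, mul_one, sub_eq_zero] at this
    exact this.symm
  have heA : e ∈ A := by
    rw [← hQ.right_double_ann A hA, hlA]
    intro x hx
    rw [show x = 0 from hx, zero_mul]
  have : e * e ∈ gradedJacobson 𝒜 := heA
  rw [he.idem.eq] at this
  exact he.notMem_gradedJacobson hQ.artinian.1 this

/-- `Rw` lies in every nonzero graded left ideal inside `Rf`, so it is the only graded simple one.
-/
theorem IsGradedQuasiFrobenius.leftIdeal_inf_leftSocle_eq (hQ : IsGradedQuasiFrobenius 𝒜)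
    {t : ℕ} {e : Fin t → R} (he : IsRepresentativeSystem 𝒜 e) {f : R}
    (hf : IsPrimitiveIdempotent 𝒜 f) {w : R} {g : G} (hw : w ∈ 𝒜 g) (hw0 : w ≠ 0)
    (hwT : w ∈ rightSocle 𝒜) (hwf : w * f = w) : leftIdeal f ⊓ leftSocle 𝒜 = leftIdeal w := by
  rw [← he.gradedSocle_eq hQ.artinian.1 (isHomogeneous_leftIdeal hf.mem_zero)]
  have hwle : leftIdeal w ≤ leftIdeal f :=
    leftIdeal_le.2 ((mem_leftIdeal_iff_mul_eq hf.idem).2 hwf)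
  have key : ∀ q : Submodule R R, q.IsHomogeneous 𝒜 → q ≤ leftIdeal f → q ≠ ⊥ →
      leftIdeal w ≤ q := by
    intro q hq hqf hq0
    obtain ⟨h, z, hz, hzq, hz0⟩ := exists_homogeneous_ne_zero hq hq0
    refine leftIdeal_le.2 (leftIdeal_le.2 hzq ?_)
    exact hQ.mem_leftIdeal_of_mem_rightSocle hf hz hz0
      ((mem_leftIdeal_iff_mul_eq hf.idem).1 (hqf hzq)) hwT hwf
  have hne : leftIdeal w ≠ ⊥ := fun h => hw0 (by simpa [leftIdeal] using h)
  refine le_antisymm (sSup_le fun q hq => ?_) (le_sSup ⟨hwle, isHomogeneous_leftIdeal hw, hne,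
    fun q hq hqw => or_iff_not_imp_left.2 fun hq0 =>
      le_antisymm hqw (key q hq (hqw.trans hwle) hq0)⟩)
  exact ((hq.2.eq_bot_or_eq _ (isHomogeneous_leftIdeal hw)
    (key q hq.2.homogeneous hq.1 hq.2.ne_bot)).resolve_left hne).ge

variable {t : ℕ} {e : Fin t → R}

/-- The `e k` generate `R`, so some `e k * (b * w)` is nonzero, and left multiplication keeps `w` in
the right socle and fixed by `e i`. -/
theorem IsGradedQuasiFrobenius.exists_generator (hQ : IsGradedQuasiFrobenius 𝒜)
    (he : IsRepresentativeSystem 𝒜 e) (i : Fin t) :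
    ∃ k g, ∃ x ∈ 𝒜 g, x ≠ 0 ∧ e k * x = x ∧ x * e i = x ∧ x ∈ rightSocle 𝒜 := by
  obtain ⟨g, w, hw, hw0, hwT, hwe⟩ := hQ.exists_mem_rightSocle (he.isPrimitiveIdempotent i)
  by_contra! hc
  refine hw0 ?_
  have : w ∈ (⊥ : Submodule R R) := he.mem_of_left hQ.artinian.1 _ fun k h b hb => by
    by_contra hne
    refine hc k _ _ (SetLike.mul_mem_graded (he.mem_zero k) (SetLike.mul_mem_graded hb hw)) hne
      (by rw [← mul_assoc, (he.idempotent k).eq]) (by rw [mul_assoc, mul_assoc, hwe])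
      (mul_left_mem_rightSocle (mul_left_mem_rightSocle hwT b) _)
  simpa using this

theorem IsGradedQuasiFrobenius.rightSocle_le_leftSocle (hQ : IsGradedQuasiFrobenius 𝒜)
    (he : IsRepresentativeSystem 𝒜 e) {x : R} (hx : x ∈ rightSocle 𝒜) : x ∈ leftSocle 𝒜 := by
  -- `L` has the elements of `leftSocle 𝒜` but is a right ideal, as `mem_of_right` requires.
  let L : Submodule Rᵐᵒᵖ R := rightAnn (gradedJacobson 𝒜 : Set R)
  refine he.mem_of_right hQ.artinian.1 L fun i g b hb => ?_
  obtain ⟨k, w, hw, hw0, hwT, hwe⟩ := hQ.exists_mem_rightSocle (he.isPrimitiveIdempotent i)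
  have hmem := hQ.mem_leftIdeal_of_mem_rightSocle (he.isPrimitiveIdempotent i) hw hw0 hwe
    (w := x * b * e i) (mul_mem_right_submodule _ (mul_mem_right_submodule _ hx b) _)
    (by rw [mul_assoc, (he.idempotent i).eq])
  rw [← hQ.leftIdeal_inf_leftSocle_eq he (he.isPrimitiveIdempotent i) hw hw0 hwT hwe] at hmem
  exact hmem.2

/-- Two homogeneous generators of the same right socle determine the isoshift type of the
idempotents fixing them on the right. -/
theorem IsGradedQuasiFrobenius.sameIsoshiftType (hQ : IsGradedQuasiFrobenius 𝒜)
    {f e₁ e₂ x₁ x₂ : R} (hf : IsPrimitiveIdempotent 𝒜 f) (h₁ : IsPrimitiveIdempotent 𝒜 e₁)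
    (h₂ : IsPrimitiveIdempotent 𝒜 e₂) {g₁ g₂ : G} (hx₁ : x₁ ∈ 𝒜 g₁) (hx₂ : x₂ ∈ 𝒜 g₂)
    (hx₁0 : x₁ ≠ 0) (hx₂0 : x₂ ≠ 0) (hfx₁ : f * x₁ = x₁) (hfx₂ : f * x₂ = x₂)
    (hxe₁ : x₁ * e₁ = x₁) (hxe₂ : x₂ * e₂ = x₂) (hL : x₁ ∈ leftSocle 𝒜)
    (hT : x₂ ∈ rightSocle 𝒜) :
    SameIsoshiftType R (subGrading 𝒜 (leftIdeal e₁)) (subGrading 𝒜 (leftIdeal e₂)) := by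
  obtain ⟨r, hr, hrx⟩ := exists_homogeneous_right_factor hx₂ hx₁
    (hQ.mem_rightIdeal_of_mem_leftSocle hf hx₂ hx₂0 hfx₂ hL hfx₁)
  have hs0 : e₂ * r * e₁ ∈ 𝒜 (-g₂ + g₁) := mul_mem_of_add_eq
    (mul_mem_of_add_eq h₂.mem_zero hr (zero_add _)) h₁.mem_zero (add_zero _)
  have hxs : x₂ * (e₂ * r * e₁) = x₁ := by
    rw [← mul_assoc, ← mul_assoc, hxe₂, hrx, hxe₁]
  have hse : e₂ * r * e₁ * e₁ = e₂ * r * e₁ := by rw [mul_assoc, h₁.idem.eq]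
  have hes : e₂ * (e₂ * r * e₁) = e₂ * r * e₁ := by
    rw [← mul_assoc, ← mul_assoc, h₂.idem.eq]
  generalize e₂ * r * e₁ = s at hs0 hxs hse hes
  -- The radical kills `x₂` from the right while `x₂ * s = x₁ ≠ 0`; so `s` becomes invertible
  -- between `e₁` and `e₂`.
  have hsJ : s ∉ gradedJacobson 𝒜 := fun h => hx₁0 (by rw [← hxs, hT s h])
  obtain ⟨b, hb, hbs⟩ := h₁.exists_left_inv hQ.artinian.1 hs0 hse hsJ
  have hb' : b * e₂ ∈ 𝒜 (-(-g₂ + g₁)) := mul_mem_of_add_eq hb h₂.mem_zero (add_zero _)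
  have hbe : b * e₂ * e₂ = b * e₂ := by rw [mul_assoc, h₂.idem.eq]
  have hbs' : b * e₂ * s = e₁ := by rw [mul_assoc, hes, hbs]
  exact sameIsoshiftType_of_mul_eq h₁.idem h₂.idem hs0 hb' hbe hse hbs'
    (h₂.mul_comm_of_mul_eq h₁.idem h₁.ne_zero hbs' hes hbe hs0 hb' hse)

theorem IsGradedQuasiFrobenius.exists_perm (hQ : IsGradedQuasiFrobenius 𝒜)
    (he : IsRepresentativeSystem 𝒜 e) :
    ∃ (π : Equiv.Perm (Fin t)) (σ : Fin t → G), ∀ i,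
      GradedIso R (subGrading 𝒜 (gradedSocle 𝒜 (leftIdeal (e i))))
        (leftShift (leftTopGrading 𝒜 (e (π i))) (σ i)) ∧
      GradedIso Rᵐᵒᵖ (subGrading 𝒜 (gradedSocle 𝒜 (rightIdeal (e (π i)))))
        (rightShift (σ i) (rightTopGrading 𝒜 (e i))) := by
  choose k g x hx hx0 hkx hxe hxT using hQ.exists_generator he
  have hp := he.isPrimitiveIdempotent
  have hA := hQ.artinian.1
  have hxL : ∀ i, x i ∈ leftSocle 𝒜 := fun i => hQ.rightSocle_le_leftSocle he (hxT i)
  -- If `k i = k j`, both `x i` and `x j` lie in the socle of the same right ideal, so `Re_i` and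
  -- `Re_j` have the same isoshift type.
  have hinj : Function.Injective k := by
    intro i j hij
    refine he.distinct i j (hQ.sameIsoshiftType (hp (k i)) (hp i) (hp j) (hx i) (hx j) (hx0 i)
      (hx0 j) (hkx i) ?_ (hxe i) (hxe j) (hxL i) (hxT j))
    rw [hij]
    exact hkx j
  refine ⟨Equiv.ofBijective k (Finite.injective_iff_bijective.1 hinj), fun i => -g i,
    fun i => ⟨?_, ?_⟩⟩
  · rw [Equiv.ofBijective_apply, he.gradedSocle_eq hA (isHomogeneous_leftIdeal (he.mem_zero i)),
      hQ.leftIdeal_inf_leftSocle_eq he (hp i) (hx i) (hx0 i) (hxT i) (hxe i)]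
    exact (hp (k i)).gradedIso_leftTop hA (hx i) (hx0 i) (hkx i) (hxL i)
  · have hsoc : gradedSocle 𝒜 (rightIdeal (e (k i))) = rightIdeal (x i) := by
      rw [he.gradedSocle_eq_right hA (isHomogeneous_rightIdeal (he.mem_zero _))]
      refine le_antisymm (fun y hy => ?_) (rightIdeal_le.2
        ⟨(mem_rightIdeal_iff_mul_eq (he.idempotent _)).2 (hkx i), hxT i⟩)
      exact hQ.mem_rightIdeal_of_mem_leftSocle (hp (k i)) (hx i) (hx0 i) (hkx i)
        (hQ.rightSocle_le_leftSocle he hy.2)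
        ((mem_rightIdeal_iff_mul_eq (he.idempotent _)).1 hy.1)
    rw [Equiv.ofBijective_apply, hsoc]
    exact (hp i).gradedIso_rightTop hA (hx i) (hx0 i) (hxe i) (hxT i)

end QuasiFrobenius

end GradedQF

theorem corollary5p8 {G R : Type*} [AddGroup G] [DecidableEq G] [Ring R]
    (𝒜 : G → AddSubgroup R) [GradedRing 𝒜] (hR : GradedQF.IsGradedArtinianRing 𝒜)
    (t : ℕ) (e : Fin t → R) (he : GradedQF.IsRepresentativeSystem 𝒜 e) :
    GradedQF.IsGradedQuasiFrobenius 𝒜 ↔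
      ∃ (π : Equiv.Perm (Fin t)) (σ : Fin t → G), ∀ i,
        GradedQF.GradedIso R
          (GradedQF.subGrading 𝒜 (GradedQF.gradedSocle 𝒜 (GradedQF.leftIdeal (e i))))
          (GradedQF.leftShift (GradedQF.leftTopGrading 𝒜 (e (π i))) (σ i)) ∧
        GradedQF.GradedIso Rᵐᵒᵖ
          (GradedQF.subGrading 𝒜 (GradedQF.gradedSocle 𝒜 (GradedQF.rightIdeal (e (π i)))))
          (GradedQF.rightShift (σ i) (GradedQF.rightTopGrading 𝒜 (e i))) :=
  ⟨fun hQ => hQ.exists_perm he, fun ⟨π, _, h⟩ => he.isGradedQuasiFrobenius_of_generators hR π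
    (fun i => (he.isPrimitiveIdempotent (π i)).exists_generator_of_gradedIso hR.1 (h i).1)
    (fun i => (he.isPrimitiveIdempotent i).exists_generator_of_gradedIso_right hR.1 (h i).2)⟩
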